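/- Let $\mathbf H^2_{\mathbb C}$ be the complex hyperbolic plane (negative lines in $\mathbb C^3$ for a Hermitian form $\langle\cdot,\cdot\rangle$ of signature $(2,1)$), $\partial\mathbf H^2_{\mathbb C}$ its boundary (null lines), and $\mathrm{PU}(2,1)$ its group of holomorphic isometries. An element of $\mathrm{PU}(2,1)$ is *parabolic* if it fixes no point of $\mathbf H^2_{\mathbb C}$ and exactly one point of $\partial\mathbf H^2_{\mathbb C}$; it is *regular elliptic* if it fixes a point of $\mathbf H^2_{\mathbb C}$ and its lifts to $\mathrm U(2,1)$ have three pairwise distinct eigenvalues. A *non-degenerate balanced ideal tetrahedron* is an ordered quadruple $\tau=(p_1,p_2,p_3,p_4)$ of pairwise distinct points of $\partial\mathbf H^2_{\mathbb C}$ such that $p_3$ and $p_4$ have the same orthogonal projection onto the real geodesic $(p_1p_2)$. (The orthogonal projection of an ideal point $z$ is the point of the geodesic that is nearest to $z$, as measured by the horospheres based at $z$.) A *marked $(3,3,\infty)$-group* in $\mathrm{PU}(2,1)$ is a group $\langle J_1,J_2\rangle$ given with its ordered pair of generators, where $J_1,J_2\in\mathrm{PU}(2,1)$ are regular elliptic of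 order $3$ and $J_1J_2$ is parabolic. A *$(3,3,\infty)$-group* is a subgroup of $\mathrm{PU}(2,1)$ generated by such a pair. Conjugacy of marked groups is simultaneous conjugacy of the pairs $(J_1,J_2)$ by elements of $\mathrm{PU}(2,1)$. Say that $(J_1,J_2)$ is *attached* to $\tau$ if $J_1$ maps $p_2\mapsto p_1\mapsto p_3\mapsto p_2$ and $J_2$ maps $p_1\mapsto p_2\mapsto p_4\mapsto p_1$. **Theorem 4.6.** 1. There is a bijection $F$ from the set of $\mathrm{PU}(2,1)$-orbits of non-degenerate balanced ideal tetrahedra onto the set of $\mathrm{PU}(2,1)$-conjugacy classes of marked $(3,3,\infty)$-groups such that, for every non-degenerate balanced ideal tetrahedron $\tau$ and every marked $(3,3,\infty)$-group $(J_1,J_2)$, $F([\tau])=[(J_1,J_2)]$ if and only if $(J_1,J_2)$ is attached to $g\tau$ for some $g\in\mathrm{PU}(2,1)$. 2. There is also a bijection between the set of $\mathrm{PU}(2,1)$-orbits of non-degenerate balanced ideal tetrahedra and the set of $\mathrm{PU}(2,1)$-conjugacy classes of subgroups of $\mathrm{PU}(2,1)$ that are $(3,3,\infty)$-groups. -/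

import Mathlib

open scoped LinearAlgebra.Projectivization MatrixGroups

noncomputable section

namespace ComplexHyperbolic

/-- The vector space `ℂ³`. -/
abbrev V : Type := Fin 3 → ℂ

/-- The Hermitian form of signature `(2,1)` on `ℂ³`:
`⟨z,w⟩ = z₁ w̄₃ + z₂ w̄₂ + z₃ w̄₁`, linear in `z` and conjugate linear in `w`. -/
def herm (z w : V) : ℂ :=
  z 0 * star (w 2) + z 1 * star (w 1) + z 2 * star (w 0)

/-- The group `U(2,1)` of complex matrices preserving the form. -/
def U21 : Subgroup (GL (Fin 3) ℂ) where
  carrier := {A | ∀ z w : V, herm (A • z) (A • w) = herm z w}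
  one_mem' := fun z w => by simp
  mul_mem' := fun {A B} hA hB z w => by rw [mul_smul, mul_smul, hA, hB]
  inv_mem' := fun {A} hA z w => by
    have h := hA (A⁻¹ • z) (A⁻¹ • w)
    rw [smul_inv_smul, smul_inv_smul] at h
    exact h.symm

/-- The projective unitary group `PU(2,1)`: the image of `U(2,1)` in `PGL(3,ℂ)`.
It acts on the projective plane `ℙ(ℂ³)` through the action of `PGL(3,ℂ)`. -/
def PU21 : Subgroup PGL(3, ℂ) := U21.map Matrix.ProjGenLinGroup.mk

/-- The complex hyperbolic plane: the set of negative lines in `ℂ³`. -/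
def hyperbolicPlane : Set (ℙ ℂ V) := {x | (herm x.rep x.rep).re < 0}

/-- The boundary at infinity of the complex hyperbolic plane: the set of null lines in `ℂ³`. -/
def boundary : Set (ℙ ℂ V) := {x | herm x.rep x.rep = 0}

/-! ### Types of isometries -/

/-- An isometry is elliptic if it fixes a point of the complex hyperbolic plane. -/
def IsElliptic (g : PU21) : Prop := ∃ x ∈ hyperbolicPlane, g • x = x

/-- An elliptic isometry is regular if its lifts have three pairwise distinct eigenvalues. -/
def IsRegularElliptic (g : PU21) : Prop :=
  IsElliptic g ∧ ∀ A ∈ U21, Matrix.ProjGenLinGroup.mk A = (g : PGL(3, ℂ)) →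
    {μ : ℂ | Module.End.HasEigenvalue (Matrix.toLin' (A : Matrix (Fin 3) (Fin 3) ℂ)) μ}.ncard = 3

/-- An isometry is parabolic if it has no fixed point in the complex hyperbolic plane
and exactly one fixed point on the boundary. -/
def IsParabolic (g : PU21) : Prop :=
  (∀ x ∈ hyperbolicPlane, g • x ≠ x) ∧ ∃! x : ℙ ℂ V, x ∈ boundary ∧ g • x = x

/-! ### Balanced ideal tetrahedra -/

/-- The (real) geodesic of the complex hyperbolic plane with endpoints the boundary points
`p ≠ q`. If `v₀`, `w₀` are lifts of `p`, `q` with `⟨v₀,w₀⟩ = -1`, it is the curve of points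
spanned by `e^t v₀ + e^(-t) w₀`; the vectors `e^t v₀` and `e^(-t) w₀` are again lifts
with product `-1`, and any two such lifts differ from these by a common phase. -/
def geodesic (p q : ℙ ℂ V) : Set (ℙ ℂ V) :=
  {x | ∃ (v w : V) (hv : v ≠ 0) (hw : w ≠ 0) (h : v + w ≠ 0),
    Projectivization.mk ℂ v hv = p ∧ Projectivization.mk ℂ w hw = q ∧
    herm v w = -1 ∧ Projectivization.mk ℂ (v + w) h = x}

/-- For a fixed point `z` of the closed complex hyperbolic plane, this function of the point `y` of
the complex hyperbolic plane orders points by their distance to `z`. It does not depend on the lift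
of `y`, and changing the lift of `z` multiplies it by a positive constant.
When `z` is negative, it is a positive multiple of
`cosh² (d(z,y)/2) = ⟨z,y⟩⟨y,z⟩ / (⟨z,z⟩⟨y,y⟩)`, where `d` is the Bergman distance.
When `z` is null, its logarithm is, up to an additive constant, the Busemann function
(normalised limit of distance functions) of `z`, and its level sets are the horospheres
based at `z`. -/
def remoteness (z y : ℙ ℂ V) : ℝ :=
  ‖herm z.rep y.rep‖ ^ 2 / (-(herm y.rep y.rep).re)

/-- The point `x` is the orthogonal projection of `z` on the geodesic with endpoints `p` and `q`:
it is the nearest point to `z` on that geodesic, where for an ideal point `z` nearness is measured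
by the horospheres based at `z` (so that the projection extends continuously to the boundary
points other than `p` and `q`). -/
def IsOrthogonalProjection (p q z x : ℙ ℂ V) : Prop :=
  x ∈ geodesic p q ∧ ∀ y ∈ geodesic p q, remoteness z x ≤ remoteness z y

/-- An ideal tetrahedron (an ordered quadruple of boundary points) `(p₁,p₂,p₃,p₄)` is balanced if
`p₃` and `p₄` have the same orthogonal projection on the geodesic `(p₁p₂)`. -/
def IsBalanced (τ : Fin 4 → ℙ ℂ V) : Prop :=
  ∃ x, IsOrthogonalProjection (τ 0) (τ 1) (τ 2) x ∧ IsOrthogonalProjection (τ 0) (τ 1) (τ 3) x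

/-- Non-degenerate (pairwise distinct vertices) balanced ideal tetrahedra. -/
def BalancedTetrahedron : Type :=
  {τ : Fin 4 → ℙ ℂ V // (∀ i, τ i ∈ boundary) ∧ Function.Injective τ ∧ IsBalanced τ}

/-- Two balanced tetrahedra are equivalent if they lie in the same `PU(2,1)`-orbit. -/
def tetrahedronSetoid : Setoid BalancedTetrahedron :=
  (MulAction.orbitRel PU21 (Fin 4 → ℙ ℂ V)).comap Subtype.val

/-- The set of `PU(2,1)`-orbits of non-degenerate balanced ideal tetrahedra. -/
def TetrahedronOrbits : Type := Quotient tetrahedronSetoid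

/-! ### `(3,3,∞)`-groups -/

/-- `J.1` and `J.2` are regular elliptic of order `3` and their product is parabolic. -/
def Is33InftyPair (J : PU21 × PU21) : Prop :=
  (IsRegularElliptic J.1 ∧ orderOf J.1 = 3) ∧ (IsRegularElliptic J.2 ∧ orderOf J.2 = 3) ∧
    IsParabolic (J.1 * J.2)

/-- `(3,3,∞)`-groups `⟨J₁,J₂⟩` in `PU(2,1)`, given with their ordered pair of generators. -/
def Marked33InftyGroup : Type := {J : PU21 × PU21 // Is33InftyPair J}

/-- Simultaneous conjugation by elements of `PU(2,1)`. -/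
def markedSetoid : Setoid Marked33InftyGroup :=
  (MulAction.orbitRel (ConjAct PU21) (PU21 × PU21)).comap Subtype.val

/-- The set of `PU(2,1)`-conjugacy classes of marked `(3,3,∞)`-groups. -/
def Marked33InftyClasses : Type := Quotient markedSetoid

/-- Subgroups of `PU(2,1)` that are `(3,3,∞)`-groups for some choice of generators. -/
def Unmarked33InftyGroup : Type :=
  {H : Subgroup PU21 // ∃ J : PU21 × PU21, Is33InftyPair J ∧ H = Subgroup.closure {J.1, J.2}}

open scoped Pointwise in
/-- Conjugation of subgroups by elements of `PU(2,1)`. -/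
def unmarkedSetoid : Setoid Unmarked33InftyGroup :=
  (MulAction.orbitRel (ConjAct PU21) (Subgroup PU21)).comap Subtype.val

/-- The set of `PU(2,1)`-conjugacy classes of subgroups of `PU(2,1)` that are `(3,3,∞)`-groups. -/
def Unmarked33InftyClasses : Type := Quotient unmarkedSetoid

/-- `J` maps `a` to `b`, `b` to `c` and `c` to `a`. -/
def CyclicallyPermutes (J : PU21) (a b c : ℙ ℂ V) : Prop :=
  J • a = b ∧ J • b = c ∧ J • c = a

/-- The pair `(J₁,J₂)` is attached to `(p₁,p₂,p₃,p₄)` if `J₁` cyclically permutes `p₂,p₁,p₃`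
and `J₂` cyclically permutes `p₁,p₂,p₄`. -/
def IsAttached (τ : Fin 4 → ℙ ℂ V) (J : PU21 × PU21) : Prop :=
  CyclicallyPermutes J.1 (τ 1) (τ 0) (τ 2) ∧ CyclicallyPermutes J.2 (τ 0) (τ 1) (τ 3)

end ComplexHyperbolic

end

namespace ComplexHyperbolic

open Matrix ComplexConjugate

/-! ### The Hermitian form -/

lemma herm_add_left (x y z : V) : herm (x + y) z = herm x z + herm y z := by
  simp only [herm, Pi.add_apply]; ring

lemma herm_add_right (x y z : V) : herm x (y + z) = herm x y + herm x z := by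
  simp only [herm, Pi.add_apply, star_add]; ring

lemma herm_smul_left (a : ℂ) (x y : V) : herm (a • x) y = a * herm x y := by
  simp only [herm, Pi.smul_apply, smul_eq_mul]; ring

lemma herm_smul_right (a : ℂ) (x y : V) : herm x (a • y) = conj a * herm x y := by
  simp only [herm, Pi.smul_apply, smul_eq_mul, star_mul', RCLike.star_def]; ring

lemma herm_sub_left (x y z : V) : herm (x - y) z = herm x z - herm y z := by
  simp only [herm, Pi.sub_apply]; ring

lemma herm_sub_right (x y z : V) : herm x (y - z) = herm x y - herm x z := by
  simp only [herm, Pi.sub_apply, star_sub]; ring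

lemma conj_herm (x y : V) : conj (herm x y) = herm y x := by
  simp only [herm, RCLike.star_def, map_add, map_mul, Complex.conj_conj]; ring

lemma herm_zero_left (x : V) : herm 0 x = 0 := by simp [herm]

lemma herm_zero_right (x : V) : herm x 0 = 0 := by simp [herm]

lemma herm_comm_eq_zero {x y : V} (h : herm x y = 0) : herm y x = 0 := by
  rw [← conj_herm, h, map_zero]

lemma norm_herm_comm (x y : V) : ‖herm x y‖ = ‖herm y x‖ := by
  rw [← conj_herm, RCLike.norm_conj]

/-- The Gram matrix of the form in the standard basis. -/
def gram : Matrix (Fin 3) (Fin 3) ℂ := !![0, 0, 1; 0, 1, 0; 1, 0, 0]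

lemma gram_mul_gram : gram * gram = 1 := by
  ext i j; fin_cases i <;> fin_cases j <;> simp [gram, mul_apply, Fin.sum_univ_three]

/-- A matrix is unitary for the form. -/
def IsUnitary (M : Matrix (Fin 3) (Fin 3) ℂ) : Prop :=
  ∀ z w : V, herm (M *ᵥ z) (M *ᵥ w) = herm z w

/-- The adjoint of a matrix with respect to the form. -/
def adj (M : Matrix (Fin 3) (Fin 3) ℂ) : Matrix (Fin 3) (Fin 3) ℂ := gram * Mᴴ * gram

lemma herm_mulVec_right (M : Matrix (Fin 3) (Fin 3) ℂ) (x y : V) :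
    herm x (M *ᵥ y) = herm (adj M *ᵥ x) y := by
  simp [herm, adj, gram, mulVec, vecMul, dotProduct, Fin.sum_univ_three, mul_apply]
  ring

lemma herm_left_injective {x y : V} (h : ∀ z, herm x z = herm y z) : x = y := by
  have h0 := h ![0, 0, 1]
  have h1 := h ![0, 1, 0]
  have h2 := h ![1, 0, 0]
  simp [herm] at h0 h1 h2
  ext i; fin_cases i <;> simpa

lemma adj_adj (M : Matrix (Fin 3) (Fin 3) ℂ) : adj (adj M) = M := by
  simp only [adj, conjTranspose_mul, conjTranspose_conjTranspose]
  have h : gramᴴ = gram := by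
    ext i j; fin_cases i <;> fin_cases j <;> simp [gram]
  rw [h]
  calc gram * (gram * (M * gram)) * gram = (gram * gram) * M * (gram * gram) := by
        simp only [Matrix.mul_assoc]
    _ = M := by rw [gram_mul_gram, Matrix.one_mul, Matrix.mul_one]

lemma trace_adj (M : Matrix (Fin 3) (Fin 3) ℂ) : (adj M).trace = conj M.trace := by
  rw [adj, trace_mul_comm, ← Matrix.mul_assoc, gram_mul_gram, Matrix.one_mul, trace_conjTranspose]
  rfl

lemma IsUnitary.adj_mul {M : Matrix (Fin 3) (Fin 3) ℂ} (h : IsUnitary M) : adj M * M = 1 := by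
  apply Matrix.toLin'.injective
  ext1 i
  ext1
  simp only [LinearMap.comp_apply, toLin'_apply, toLin'_one, LinearMap.id_apply]
  apply herm_left_injective
  intro z
  rw [← mulVec_mulVec, ← herm_mulVec_right, h]

lemma IsUnitary.mul_adj {M : Matrix (Fin 3) (Fin 3) ℂ} (h : IsUnitary M) : M * adj M = 1 :=
  mul_eq_one_comm.mp h.adj_mul

lemma isUnitary_of_adj_mul {M : Matrix (Fin 3) (Fin 3) ℂ} (h : adj M * M = 1) : IsUnitary M := by
  intro z w
  rw [herm_mulVec_right, mulVec_mulVec, h, one_mulVec]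

lemma IsUnitary.mul {M N : Matrix (Fin 3) (Fin 3) ℂ} (hM : IsUnitary M) (hN : IsUnitary N) :
    IsUnitary (M * N) := by
  intro z w
  rw [← mulVec_mulVec, ← mulVec_mulVec, hM, hN]

lemma IsUnitary.isUnitary_adj {M : Matrix (Fin 3) (Fin 3) ℂ} (h : IsUnitary M) :
    IsUnitary (adj M) :=
  isUnitary_of_adj_mul (by rw [adj_adj, h.mul_adj])

lemma IsUnitary.mulVec_ne_zero {M : Matrix (Fin 3) (Fin 3) ℂ} (h : IsUnitary M) {x : V}
    (hx : x ≠ 0) : M *ᵥ x ≠ 0 := by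
  intro h0
  apply hx
  rw [← one_mulVec x, ← h.adj_mul, ← mulVec_mulVec, h0, mulVec_zero]

/-- The matrix with given columns. -/
def columns (u n v : V) : Matrix (Fin 3) (Fin 3) ℂ := (of ![u, n, v])ᵀ

lemma columns_mulVec (u n v x : V) : columns u n v *ᵥ x = x 0 • u + x 1 • n + x 2 • v := by
  ext i
  simp [columns, mulVec, dotProduct, Fin.sum_univ_three]
  ring

lemma isUnitary_columns {u n v : V} (hu : herm u u = 0) (hv : herm v v = 0) (huv : herm u v = 1)
    (hn : herm n n = 1) (hnu : herm n u = 0) (hnv : herm n v = 0) :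
    IsUnitary (columns u n v) := by
  intro z w
  have hvu : herm v u = 1 := by rw [← conj_herm, huv, map_one]
  simp only [columns_mulVec, herm_add_left, herm_add_right, herm_smul_left, herm_smul_right, hu, hv,
    huv, hn, hnu, hnv, hvu, herm_comm_eq_zero hnu, herm_comm_eq_zero hnv]
  simp only [herm, RCLike.star_def]
  ring

/-- A unit vector orthogonal to two null vectors with product `1`. -/
lemma exists_normal {u v : V} (hu : herm u u = 0) (huv : herm u v = 1) :
    ∃ n : V, herm n n = 1 ∧ herm n u = 0 ∧ herm n v = 0 := by
  have hvu : herm v u = 1 := by rw [← conj_herm, huv, map_one]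
  refine ⟨![conj (u 0 * v 1 - u 1 * v 0), conj (u 2 * v 0 - u 0 * v 2),
    conj (u 1 * v 2 - u 2 * v 1)], ?_, ?_, ?_⟩
  · have : herm u v * herm v u - herm u u * herm v v = 1 := by rw [hu, huv, hvu]; ring
    rw [← this]
    simp [herm]
    ring
  · simp [herm]; ring
  · simp [herm]; ring

/-- Two null vectors with product `1` are completed to a basis adapted to the form. -/
lemma exists_unitary_columns {u v : V} (hu : herm u u = 0) (hv : herm v v = 0)
    (huv : herm u v = 1) : ∃ n : V, herm n n = 1 ∧ herm n u = 0 ∧ herm n v = 0 ∧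
      IsUnitary (columns u n v) ∧ ∀ y, y = herm y v • u + herm y n • n + herm y u • v := by
  obtain ⟨n, hn, hnu, hnv⟩ := exists_normal hu huv
  have hP := isUnitary_columns hu hv huv hn hnu hnv
  have hvu : herm v u = 1 := by rw [← conj_herm, huv, map_one]
  refine ⟨n, hn, hnu, hnv, hP, fun y => ?_⟩
  obtain ⟨x, rfl⟩ : ∃ x, y = columns u n v *ᵥ x :=
    ⟨ComplexHyperbolic.adj (columns u n v) *ᵥ y, by rw [mulVec_mulVec, hP.mul_adj, one_mulVec]⟩
  simp [columns_mulVec, herm_add_left, herm_smul_left, hu, hv, huv, hvu, hn, hnu, hnv,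
    herm_comm_eq_zero hnu, herm_comm_eq_zero hnv]

lemma exists_null_herm_ne_zero {u : V} (hu0 : u ≠ 0) (hu : herm u u = 0) :
    ∃ v : V, herm v v = 0 ∧ herm u v ≠ 0 := by
  by_contra! H
  have h0 : u 0 = 0 := by simpa [herm] using H ![0, 0, 1] (by simp [herm])
  have h2 : u 2 = 0 := by simpa [herm] using H ![1, 0, 0] (by simp [herm])
  have h1 : u 1 = 0 := by simpa [herm, h0, h2] using hu
  apply hu0
  ext i; fin_cases i <;> simpa

lemma exists_null_herm_eq_one {u : V} (hu0 : u ≠ 0) (hu : herm u u = 0) :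
    ∃ v : V, herm v v = 0 ∧ herm u v = 1 := by
  obtain ⟨v, hv, huv⟩ := exists_null_herm_ne_zero hu0 hu
  refine ⟨(conj (herm u v))⁻¹ • v, ?_, ?_⟩
  · rw [herm_smul_left, herm_smul_right, hv]; ring
  · rw [herm_smul_right, map_inv₀, Complex.conj_conj, inv_mul_cancel₀ huv]

/-- A vector which is not positive and orthogonal to a null vector is a multiple of it. -/
lemma exists_eq_smul_of_herm_eq_zero {u v : V} (hu0 : u ≠ 0) (hu : herm u u = 0)
    (hv : (herm v v).re ≤ 0) (h : herm v u = 0) : ∃ c : ℂ, v = c • u := by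
  obtain ⟨x, hx, hux⟩ := exists_null_herm_eq_one hu0 hu
  obtain ⟨n, hn, hnu, hnx, -, hy⟩ := exists_unitary_columns hu hx hux
  have hv' := hy v
  rw [h, zero_smul, add_zero] at hv'
  have : herm v v = herm v n * conj (herm v n) := by
    nth_rw 2 [hv']
    rw [herm_add_right, herm_smul_right, herm_smul_right, h]; ring
  rw [this, Complex.mul_conj, Complex.ofReal_re] at hv
  have h0 : herm v n = 0 := Complex.normSq_eq_zero.mp (le_antisymm hv (Complex.normSq_nonneg _))
  exact ⟨herm v x, by nth_rw 1 [hv']; rw [h0, zero_smul, add_zero]⟩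

/-- The signature excludes three orthonormal vectors. -/
lemma not_three_orthonormal {x y z : V} (hx : herm x x = 1) (hy : herm y y = 1)
    (hz : herm z z = 1) (hxy : herm x y = 0) (hxz : herm x z = 0) (hyz : herm y z = 0) : False := by
  set N := columns x y z with hN
  have h : Nᴴ * gram * N = 1 := by
    have h1 := herm_comm_eq_zero hxy
    have h2 := herm_comm_eq_zero hxz
    have h3 := herm_comm_eq_zero hyz
    simp only [herm, RCLike.star_def] at *
    ext i j
    fin_cases i <;> fin_cases j <;>
      simp [hN, columns, gram, mul_apply, Fin.sum_univ_three] <;>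
      first
      | linear_combination hx | linear_combination hy | linear_combination hz
      | linear_combination hxy | linear_combination hxz | linear_combination hyz
      | linear_combination h1 | linear_combination h2 | linear_combination h3
  have hd := congrArg det h
  rw [det_mul, det_mul, det_conjTranspose, det_one] at hd
  have hg : gram.det = -1 := by simp [gram, det_fin_three]
  rw [hg, RCLike.star_def] at hd
  have : (Complex.normSq N.det : ℂ) = -1 := by
    rw [← Complex.mul_conj]; linear_combination -hd
  have h' : Complex.normSq N.det = -1 := by exact_mod_cast this
  linarith [Complex.normSq_nonneg N.det]

/-- An endomorphism which vanishes on a hyperbolic plane and takes its values in the orthogonal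
complement has rank at most one. -/
lemma exists_rank_one {u v : V} (hu : herm u u = 0) (hv : herm v v = 0) (huv : herm u v = 1)
    {B : Matrix (Fin 3) (Fin 3) ℂ} (hBu : B *ᵥ u = 0) (hBv : B *ᵥ v = 0)
    (hu' : ∀ y, herm (B *ᵥ y) u = 0) (hv' : ∀ y, herm (B *ᵥ y) v = 0) :
    ∃ (n : V) (t : ℂ), herm n n = 1 ∧ (∀ N : Matrix (Fin 3) (Fin 3) ℂ,
      (N * B).trace = t * herm (N *ᵥ n) n) ∧ (t = 0 → B = 0) := by
  obtain ⟨n, hn, hnu, hnx, -, hy⟩ := exists_unitary_columns hu hv huv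
  set t := herm (B *ᵥ n) n
  have hBn : B *ᵥ n = t • n := by
    have := hy (B *ᵥ n)
    rwa [hu', hv', zero_smul, zero_smul, zero_add, add_zero] at this
  have hBy : ∀ y, B *ᵥ y = (t * herm y n) • n := fun y => by
    conv_lhs => rw [hy y]
    rw [mulVec_add, mulVec_add, mulVec_smul, mulVec_smul, mulVec_smul, hBu, hBv, hBn, smul_zero,
      smul_zero, zero_add, add_zero, smul_smul, mul_comm]
  have hB : B = t • vecMulVec n ![conj (n 2), conj (n 1), conj (n 0)] := by
    apply Matrix.toLin'.injective
    apply LinearMap.ext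
    intro y
    rw [toLin'_apply, toLin'_apply, hBy, smul_mulVec, vecMulVec_mulVec]
    ext i
    simp [herm, dotProduct, Fin.sum_univ_three]
    ring
  refine ⟨n, t, hn, fun N => ?_, fun ht => by rw [hB, ht, zero_smul]⟩
  rw [hB, Matrix.mul_smul, trace_smul, mul_vecMulVec, trace_vecMulVec]
  simp [herm, dotProduct, Fin.sum_univ_three]

/-! ### Matrices whose cube is scalar -/

lemma hasEigenvalue_iff_mem_roots (M : Matrix (Fin 3) (Fin 3) ℂ) (μ : ℂ) :
    Module.End.HasEigenvalue (toLin' M) μ ↔ μ ∈ M.charpoly.roots := by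
  rw [Module.End.hasEigenvalue_iff_isRoot_charpoly, charpoly_toLin',
    Polynomial.mem_roots M.charpoly_monic.ne_zero]

lemma pow_three_mulVec {M : Matrix (Fin 3) (Fin 3) ℂ} {c : ℂ} (hM : M ^ 3 = c • 1) (x : V) :
    M *ᵥ M *ᵥ M *ᵥ x = c • x := by
  rw [mulVec_mulVec, mulVec_mulVec, ← pow_two, ← pow_succ, hM, smul_mulVec,
    one_mulVec]

lemma pow_three_eq_of_mem_roots {M : Matrix (Fin 3) (Fin 3) ℂ} {c μ : ℂ} (hM : M ^ 3 = c • 1)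
    (h : μ ∈ M.charpoly.roots) : μ ^ 3 = c := by
  rw [← hasEigenvalue_iff_mem_roots] at h
  obtain ⟨v, hv⟩ := h.exists_hasEigenvector
  have h1 : M *ᵥ v = μ • v := by simpa using hv.apply_eq_smul
  have h3 := pow_three_mulVec hM v
  rw [h1, mulVec_smul, h1, mulVec_smul, mulVec_smul, h1, smul_smul, smul_smul] at h3
  have := smul_left_injective ℂ hv.2 h3
  rw [← this]; ring

lemma exists_roots_charpoly (M : Matrix (Fin 3) (Fin 3) ℂ) :
    ∃ x y z, M.charpoly.roots = {x, y, z} := by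
  rw [← Multiset.card_eq_three, IsAlgClosed.card_roots_eq_natDegree, charpoly_natDegree_eq_dim,
    Fintype.card_fin]

/-- Three cube roots of the same nonzero number with vanishing sum are distinct. -/
lemma ne_of_cube_eq {x y z c : ℂ} (hc : c ≠ 0) (hx : x ^ 3 = c) (hz : z ^ 3 = c)
    (h : x + y + z = 0) :
    x ≠ y := by
  rintro rfl
  obtain rfl : z = -2 * x := by linear_combination h
  apply hc
  linear_combination (-1 / 9 : ℂ) * hz + (-8 / 9 : ℂ) * hx

lemma ncard_eigenvalues {M : Matrix (Fin 3) (Fin 3) ℂ} {c : ℂ} (hc : c ≠ 0) (hM : M ^ 3 = c • 1)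
    (ht : M.trace = 0) : {μ : ℂ | Module.End.HasEigenvalue (toLin' M) μ}.ncard = 3 := by
  obtain ⟨x, y, z, h⟩ := exists_roots_charpoly M
  have hs : x + y + z = 0 := by
    rw [← ht, trace_eq_sum_roots_charpoly, h]; simp; ring
  have hx := pow_three_eq_of_mem_roots hM (μ := x) (by simp [h])
  have hy := pow_three_eq_of_mem_roots hM (μ := y) (by simp [h])
  have hz := pow_three_eq_of_mem_roots hM (μ := z) (by simp [h])
  rw [Set.ncard_eq_three]
  refine ⟨x, y, z, ne_of_cube_eq hc hx hz hs,
    ne_of_cube_eq hc hx hy (by linear_combination hs),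
    ne_of_cube_eq hc hy hx (by linear_combination hs), ?_⟩
  ext μ
  simp [hasEigenvalue_iff_mem_roots, h]

lemma sum_eq_zero_of_cube_eq {x y z c : ℂ} (hx : x ^ 3 = c) (hy : y ^ 3 = c) (hz : z ^ 3 = c)
    (hxy : x ≠ y) (hxz : x ≠ z) (hyz : y ≠ z) : x + y + z = 0 := by
  have h1 : x ^ 2 + x * y + y ^ 2 = 0 :=
    mul_left_cancel₀ (sub_ne_zero.mpr hxy) (by linear_combination hx - hy)
  have h2 : x ^ 2 + x * z + z ^ 2 = 0 :=
    mul_left_cancel₀ (sub_ne_zero.mpr hxz) (by linear_combination hx - hz)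
  exact mul_left_cancel₀ (sub_ne_zero.mpr hyz) (by linear_combination h1 - h2)

lemma trace_eq_zero_of_ncard {M : Matrix (Fin 3) (Fin 3) ℂ} {c : ℂ} (hM : M ^ 3 = c • 1)
    (h3 : {μ : ℂ | Module.End.HasEigenvalue (toLin' M) μ}.ncard = 3) : M.trace = 0 := by
  obtain ⟨x, y, z, h⟩ := exists_roots_charpoly M
  have hx := pow_three_eq_of_mem_roots hM (μ := x) (by simp [h])
  have hy := pow_three_eq_of_mem_roots hM (μ := y) (by simp [h])
  have hz := pow_three_eq_of_mem_roots hM (μ := z) (by simp [h])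
  have hset : {μ : ℂ | Module.End.HasEigenvalue (toLin' M) μ} = {x, y, z} := by
    ext μ
    simp [hasEigenvalue_iff_mem_roots, h]
  rw [hset] at h3
  have hpair (a b : ℂ) : ({a, b} : Set ℂ).ncard ≠ 3 := by
    have := Set.ncard_insert_le a {b}
    rw [Set.ncard_singleton] at this
    omega
  have hxy : x ≠ y := by
    rintro rfl
    exact hpair x z (by simpa using h3)
  have hxz : x ≠ z := by
    rintro rfl
    exact hpair y x (by simpa using h3)
  have hyz : y ≠ z := by
    rintro rfl
    exact hpair x y (by simpa using h3)
  rw [trace_eq_sum_roots_charpoly, h]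
  simpa [add_assoc] using sum_eq_zero_of_cube_eq hx hy hz hxy hxz hyz

lemma IsUnitary.pow_three_scalar {M : Matrix (Fin 3) (Fin 3) ℂ} {c : ℂ} (hU : IsUnitary M)
    (hM : M ^ 3 = c • 1) : c * conj c = 1 := by
  have hx : herm ![0, 1, 0] ![0, 1, 0] = 1 := by simp [herm]
  have : herm (M *ᵥ M *ᵥ M *ᵥ ![0, 1, 0]) (M *ᵥ M *ᵥ M *ᵥ ![0, 1, 0]) = 1 := by
    rw [hU, hU, hU, hx]
  rwa [pow_three_mulVec hM, herm_smul_left, herm_smul_right, hx, mul_one] at this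

lemma IsUnitary.pow_three_scalar_ne_zero {M : Matrix (Fin 3) (Fin 3) ℂ} {c : ℂ} (hU : IsUnitary M)
    (hM : M ^ 3 = c • 1) : c ≠ 0 := left_ne_zero_of_mul_eq_one (hU.pow_three_scalar hM)

/-- Eigenvectors of a unitary matrix for distinct unit eigenvalues are orthogonal. -/
lemma IsUnitary.herm_eq_zero {M : Matrix (Fin 3) (Fin 3) ℂ} (hU : IsUnitary M) {x y : V} {a b : ℂ}
    (hx : M *ᵥ x = a • x) (hy : M *ᵥ y = b • y) (hb : b * conj b = 1) (hab : a ≠ b) :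
    herm x y = 0 := by
  have h := hU x y
  rw [hx, hy, herm_smul_left, herm_smul_right] at h
  by_contra h0
  apply hab
  have h1 : a * conj b = 1 := mul_right_cancel₀ h0 (by linear_combination h)
  linear_combination (-a) * hb + b * h1

lemma exists_negative_eigenvector {M : Matrix (Fin 3) (Fin 3) ℂ} {c : ℂ} (hU : IsUnitary M)
    (hM : M ^ 3 = c • 1) (ht : M.trace = 0) :
    ∃ (v : V) (μ : ℂ), (herm v v).re < 0 ∧ M *ᵥ v = μ • v := by
  have hc := hU.pow_three_scalar hM
  have hc0 := hU.pow_three_scalar_ne_zero hM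
  obtain ⟨x, y, z, h⟩ := exists_roots_charpoly M
  have hs : x + y + z = 0 := by
    rw [← ht, trace_eq_sum_roots_charpoly, h]; simp; ring
  have hx := pow_three_eq_of_mem_roots hM (μ := x) (by simp [h])
  have hy := pow_three_eq_of_mem_roots hM (μ := y) (by simp [h])
  have hz := pow_three_eq_of_mem_roots hM (μ := z) (by simp [h])
  have hxy := ne_of_cube_eq hc0 hx hz hs
  have hxz := ne_of_cube_eq hc0 hx hy (y := z) (by linear_combination hs)
  have hyz := ne_of_cube_eq hc0 hy hx (y := z) (by linear_combination hs)
  have hunit (b : ℂ) (hb : b ^ 3 = c) : b * conj b = 1 := by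
    rw [← hb, map_pow, ← mul_pow, Complex.mul_conj] at hc
    rw [Complex.mul_conj]
    norm_cast at hc ⊢
    exact (pow_eq_one_iff_of_nonneg (Complex.normSq_nonneg b) (by norm_num)).mp hc
  set e : V := ![1, 0, -1] with he
  set v : ℂ → V := fun b => b ^ 2 • e + b • (M *ᵥ e) + M *ᵥ M *ᵥ e with hv
  have hev (b : ℂ) (hb : b ^ 3 = c) : M *ᵥ v b = b • v b := by
    simp only [hv, mulVec_add, mulVec_smul, pow_three_mulVec hM, ← hb]
    module
  by_contra! H
  have hpos (b : ℂ) (hb : b ^ 3 = c) : 0 ≤ (herm (v b) (v b)).re := by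
    by_contra! hneg
    exact H _ b hneg (hev b hb)
  have hsum : x • v x + y • v y + z • v z = (3 * c) • e := by
    have h2 : x ^ 2 + y ^ 2 + z ^ 2 = 0 := by
      have : x ^ 2 + x * y + y ^ 2 = 0 :=
        mul_left_cancel₀ (sub_ne_zero.mpr hxy) (by linear_combination hx - hy)
      linear_combination 2 * this + (z - x - y) * hs
    have : x • v x + y • v y + z • v z = (x ^ 3 + y ^ 3 + z ^ 3) • e +
        (x ^ 2 + y ^ 2 + z ^ 2) • (M *ᵥ e) + (x + y + z) • (M *ᵥ M *ᵥ e) := by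
      simp only [hv]; module
    rw [this, h2, hs, hx, hy, hz]
    module
  have o1 := hU.herm_eq_zero (hev x hx) (hev y hy) (hunit y hy) hxy
  have o2 := hU.herm_eq_zero (hev x hx) (hev z hz) (hunit z hz) hxz
  have o3 := hU.herm_eq_zero (hev y hy) (hev z hz) (hunit z hz) hyz
  have hee : herm e e = -2 := by simp [herm, he]; norm_num
  have key : herm (v x) (v x) + herm (v y) (v y) + herm (v z) (v z) = -18 := by
    have := congrArg (fun w => herm w w) hsum
    simp only [herm_add_left, herm_add_right, herm_smul_left, herm_smul_right, o1, o2, o3,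
      herm_comm_eq_zero o1, herm_comm_eq_zero o2, herm_comm_eq_zero o3, hee, map_mul,
      map_ofNat] at this
    linear_combination this - herm (v x) (v x) * hunit x hx - herm (v y) (v y) * hunit y hy
      - herm (v z) (v z) * hunit z hz - 18 * hc
  have key' := congrArg Complex.re key
  simp at key'
  linarith [hpos x hx, hpos y hy, hpos z hz]

/-! ### Points and lifts -/

lemma mem_U21_iff {A : GL (Fin 3) ℂ} : A ∈ U21 ↔ IsUnitary (A : Matrix (Fin 3) (Fin 3) ℂ) :=
  Iff.rfl

lemma mk_mem_hyperbolicPlane {v : V} (hv : v ≠ 0) :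
    Projectivization.mk ℂ v hv ∈ hyperbolicPlane ↔ (herm v v).re < 0 := by
  obtain ⟨a, ha⟩ := Projectivization.exists_smul_eq_mk_rep ℂ v hv
  rw [hyperbolicPlane, Set.mem_ofPred_eq, ← ha, Units.smul_def, herm_smul_left, herm_smul_right,
    ← mul_assoc, Complex.mul_conj, Complex.re_ofReal_mul]
  have := Complex.normSq_pos.mpr a.ne_zero
  exact ⟨fun h => by nlinarith, fun h => mul_neg_of_pos_of_neg this h⟩

lemma mk_mem_boundary {v : V} (hv : v ≠ 0) :
    Projectivization.mk ℂ v hv ∈ boundary ↔ herm v v = 0 := by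
  obtain ⟨a, ha⟩ := Projectivization.exists_smul_eq_mk_rep ℂ v hv
  rw [boundary, Set.mem_ofPred_eq, ← ha, Units.smul_def, herm_smul_left, herm_smul_right]
  simp

lemma exists_lift (g : PU21) : ∃ A ∈ U21, Matrix.ProjGenLinGroup.mk A = (g : PGL(3, ℂ)) := g.2

lemma smul_mk_eq {g : PU21} {A : GL (Fin 3) ℂ} (hA : Matrix.ProjGenLinGroup.mk A = (g : PGL(3, ℂ)))
    {v : V} (hv : v ≠ 0) (hv' : (A : Matrix (Fin 3) (Fin 3) ℂ) *ᵥ v ≠ 0) :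
    g • Projectivization.mk ℂ v hv = Projectivization.mk ℂ (A.1 *ᵥ v) hv' := by
  rw [Subgroup.smul_def, ← hA]
  rfl

lemma smul_mk_eq_mk_iff {g : PU21} {A : GL (Fin 3) ℂ} (hU : A ∈ U21)
    (hA : Matrix.ProjGenLinGroup.mk A = (g : PGL(3, ℂ))) {v w : V} (hv : v ≠ 0) (hw : w ≠ 0) :
    g • Projectivization.mk ℂ v hv = Projectivization.mk ℂ w hw ↔
      ∃ a : ℂ, A.1 *ᵥ v = a • w := by
  rw [smul_mk_eq hA hv (mem_U21_iff.mp hU |>.mulVec_ne_zero hv), Projectivization.mk_eq_mk_iff']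
  simp only [eq_comm]

lemma mk_eq_coe_iff {A B : GL (Fin 3) ℂ} :
    Matrix.ProjGenLinGroup.mk A = Matrix.ProjGenLinGroup.mk B ↔
      ∃ c : ℂ, c ≠ 0 ∧ (A : Matrix (Fin 3) (Fin 3) ℂ) = c • B.1 := by
  rw [eq_comm, Matrix.ProjGenLinGroup.mk_eq_mk_iff]
  constructor
  · rintro ⟨u, rfl⟩
    exact ⟨u, u.ne_zero, by ext; simp [mul_comm]⟩
  · rintro ⟨c, hc, h⟩
    exact ⟨Units.mk0 c hc, Units.ext (by ext; simp [h, mul_comm])⟩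

/-- Regular elliptic elements of order three are characterised by their lifts. -/
lemma isRegularElliptic_orderOf_iff {g : PU21} {A : GL (Fin 3) ℂ} (hU : A ∈ U21)
    (hA : Matrix.ProjGenLinGroup.mk A = (g : PGL(3, ℂ))) :
    (IsRegularElliptic g ∧ orderOf g = 3) ↔ (∃ c : ℂ, A.1 ^ 3 = c • 1) ∧ A.1.trace = 0 := by
  have hcube : g ^ 3 = 1 ↔ ∃ c : ℂ, A.1 ^ 3 = c • 1 := by
    rw [← Subtype.coe_inj, Subgroup.coe_pow, Subgroup.coe_one, ← hA, ← map_pow,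
      ← Matrix.ProjGenLinGroup.mk_one, mk_eq_coe_iff]
    constructor
    · rintro ⟨c, -, h⟩
      exact ⟨c, by simpa using h⟩
    · rintro ⟨c, h⟩
      exact ⟨c, (mem_U21_iff.mp hU).pow_three_scalar_ne_zero h, by simpa using h⟩
  constructor
  · rintro ⟨⟨-, h⟩, h3⟩
    obtain ⟨c, hc⟩ := hcube.mp (orderOf_dvd_iff_pow_eq_one.mp h3.dvd)
    exact ⟨⟨c, hc⟩, trace_eq_zero_of_ncard hc (h A hU hA)⟩
  · rintro ⟨⟨c, hc⟩, ht⟩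
    refine ⟨⟨?_, fun B hB hBA => ?_⟩, orderOf_eq_prime (hcube.mpr ⟨c, hc⟩) ?_⟩
    · obtain ⟨v, μ, hv, hμ⟩ := exists_negative_eigenvector hU hc ht
      have hv0 : v ≠ 0 := by
        rintro rfl
        simp [herm_zero_left] at hv
      exact ⟨_, (mk_mem_hyperbolicPlane hv0).mpr hv,
        (smul_mk_eq_mk_iff hU hA hv0 hv0).mpr ⟨μ, hμ⟩⟩
    · obtain ⟨d, hd, h⟩ := mk_eq_coe_iff.mp (hBA.trans hA.symm)
      have h3 : B.1 ^ 3 = (d ^ 3 * c) • 1 := by rw [h, smul_pow, hc, smul_smul]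
      exact ncard_eigenvalues ((mem_U21_iff.mp hB).pow_three_scalar_ne_zero h3) h3
        (by rw [h, trace_smul, ht, smul_zero])
    · rintro rfl
      have h1 : Matrix.ProjGenLinGroup.mk A = Matrix.ProjGenLinGroup.mk 1 := by
        rw [hA, map_one]; rfl
      obtain ⟨d, hd, h⟩ := mk_eq_coe_iff.mp h1
      rw [h, trace_smul] at ht
      simp [hd] at ht

/-! ### Rotations of ideal triangles -/

/-- The rotation of order three of the ideal triangle with vertices `e₃`, `e₁`, `(z, s, 1)`. -/
noncomputable def rotation (z s r : ℂ) : Matrix (Fin 3) (Fin 3) ℂ :=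
  r⁻¹ • !![z, z * conj s, r ^ 2; s, -z, 0; 1, 0, 0]

lemma trace_rotation (z s r : ℂ) : (rotation z s r).trace = 0 := by
  simp [rotation, trace_fin_three]

lemma rotation_pow_three {z s r : ℂ} (hr0 : r ≠ 0) (hr2 : r ^ 2 = z * conj z)
    (hz : z + conj z + s * conj s = 0) : rotation z s r ^ 3 = (z / r) • 1 := by
  have key : (!![z, z * conj s, r ^ 2; s, -z, 0; 1, 0, 0] : Matrix (Fin 3) (Fin 3) ℂ) ^ 3 =
      (r ^ 2 * z) • 1 := by
    rw [pow_three, hr2]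
    ext i j
    fin_cases i <;> fin_cases j <;> simp [mul_apply, Fin.sum_univ_three]
    · linear_combination z ^ 2 * hz
    · linear_combination z ^ 2 * conj s * hz
    · linear_combination z ^ 2 * conj z * hz
    · linear_combination s * z * hz
    · linear_combination -z ^ 2 * hz
    · ring
    · linear_combination z * hz
    · ring
    · ring
  rw [rotation, smul_pow, key, smul_smul]
  congr 1
  field_simp

lemma isUnitary_rotation {z s r : ℂ} (hr0 : r ≠ 0) (hr : conj r = r) (hr2 : r ^ 2 = z * conj z)
    (hz : z + conj z + s * conj s = 0) : IsUnitary (rotation z s r) := by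
  intro x y
  rw [rotation, smul_mulVec, smul_mulVec, herm_smul_left, herm_smul_right, map_inv₀, hr, hr2]
  have : herm (!![z, z * conj s, z * conj z; s, -z, 0; 1, 0, 0] *ᵥ x)
      (!![z, z * conj s, z * conj z; s, -z, 0; 1, 0, 0] *ᵥ y) = r ^ 2 * herm x y := by
    rw [hr2]
    simp [herm, mulVec, dotProduct, Fin.sum_univ_three]
    linear_combination (x 0 * conj (y 0)) * hz
  rw [this]
  field_simp

/-- An ideal triangle has a rotation of order three. -/
lemma exists_unitary_cycle {u v w : V} (hu : herm u u = 0) (hv : herm v v = 0) (hw : herm w w = 0)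
    (hvu : herm v u = 1) (hwv : herm w v = 1) (hwu : herm w u ≠ 0) :
    ∃ A : Matrix (Fin 3) (Fin 3) ℂ, IsUnitary A ∧ (∃ c : ℂ, A ^ 3 = c • 1) ∧ A.trace = 0 ∧
      (∃ a : ℂ, A *ᵥ u = a • v) ∧ (∃ a : ℂ, A *ᵥ v = a • w) ∧ ∃ a : ℂ, A *ᵥ w = a • u := by
  obtain ⟨n, hn, hnv, hnu, hP, hy⟩ := exists_unitary_columns hv hu hvu
  set P := columns v n u
  set z := herm w u
  set s := herm w n
  have hwz : w = z • v + s • n + u := by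
    have := hy w
    rwa [hwv, one_smul] at this
  have hz : z + conj z + s * conj s = 0 := by
    have huv : herm u v = 1 := by rw [← conj_herm, hvu, map_one]
    rw [← hw, hwz]
    simp only [herm_add_left, herm_add_right, herm_smul_left, herm_smul_right, hv, hn, hu,
      hnv, hnu, herm_comm_eq_zero hnv, herm_comm_eq_zero hnu, hvu, huv]
    ring
  set r : ℂ := (‖z‖ : ℂ)
  have hr0 : r ≠ 0 := by simpa [r] using hwu
  have hr : conj r = r := Complex.conj_ofReal _
  have hr2 : r ^ 2 = z * conj z := by rw [Complex.mul_conj, Complex.normSq_eq_norm_sq]; simp [r]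
  have hR := isUnitary_rotation hr0 hr hr2 hz
  have hPv : P *ᵥ ![1, 0, 0] = v := by simp [P, columns_mulVec]
  have hPu : P *ᵥ ![0, 0, 1] = u := by simp [P, columns_mulVec]
  have hPw : P *ᵥ ![z, s, 1] = w := by rw [hwz]; simp [P, columns_mulVec]
  have hA (x : V) : (P * rotation z s r * adj P) *ᵥ P *ᵥ x = P *ᵥ rotation z s r *ᵥ x := by
    rw [mulVec_mulVec, Matrix.mul_assoc, hP.adj_mul, Matrix.mul_one, mulVec_mulVec]
  refine ⟨P * rotation z s r * adj P, (hP.mul hR).mul hP.isUnitary_adj, ⟨z / r, ?_⟩, ?_, ⟨r, ?_⟩,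
    ⟨r⁻¹, ?_⟩, ⟨z / r, ?_⟩⟩
  · calc (P * rotation z s r * adj P) ^ 3
        = P * rotation z s r * (adj P * P) * rotation z s r * (adj P * P) * rotation z s r *
            adj P := by simp only [pow_three, Matrix.mul_assoc]
      _ = P * rotation z s r ^ 3 * adj P := by
          rw [hP.adj_mul]; simp only [pow_three, Matrix.mul_assoc, Matrix.mul_one]
      _ = (z / r) • 1 := by
          rw [rotation_pow_three hr0 hr2 hz, Matrix.mul_smul, Matrix.mul_one, Matrix.smul_mul,
            hP.mul_adj]
  · rw [trace_mul_comm, ← Matrix.mul_assoc, hP.adj_mul, Matrix.one_mul, trace_rotation]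
  · rw [← hPu, hA, ← hPv, ← mulVec_smul]
    congr 1
    ext i; fin_cases i <;> simp [rotation, mulVec, dotProduct, Fin.sum_univ_three]
    field_simp
  · rw [← hPv, hA, ← hPw, ← mulVec_smul]
    congr 1
    ext i; fin_cases i <;> simp [rotation, mulVec, dotProduct, Fin.sum_univ_three]
  · rw [← hPw, hA, ← hPu, ← mulVec_smul]
    congr 1
    ext i; fin_cases i <;> simp [rotation, mulVec, dotProduct, Fin.sum_univ_three]
    · rw [hr2]; linear_combination r⁻¹ * z * hz
    · ring
    · field_simp

lemma herm_ne_zero_of_mk_ne {u v : V} (hu0 : u ≠ 0) (hv0 : v ≠ 0) (hu : herm u u = 0)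
    (hv : herm v v = 0)
    (h : Projectivization.mk ℂ u hu0 ≠ Projectivization.mk ℂ v hv0) : herm u v ≠ 0 := by
  intro h0
  obtain ⟨c, rfl⟩ := exists_eq_smul_of_herm_eq_zero hv0 hv (by simp [hu]) h0
  exact h ((Projectivization.mk_eq_mk_iff' ..).mpr ⟨c, rfl⟩)

/-- An invertible unitary matrix as an element of the general linear group. -/
def IsUnitary.toGL {M : Matrix (Fin 3) (Fin 3) ℂ} (h : IsUnitary M) : GL (Fin 3) ℂ :=
  ⟨M, adj M, h.mul_adj, h.adj_mul⟩

lemma exists_cyclicallyPermutes {p q r : ℙ ℂ V} (hp : p ∈ boundary) (hq : q ∈ boundary)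
    (hr : r ∈ boundary) (hpq : p ≠ q) (hqr : q ≠ r) (hrp : r ≠ p) :
    ∃ J : PU21, (IsRegularElliptic J ∧ orderOf J = 3) ∧ CyclicallyPermutes J p q r := by
  induction p using Projectivization.ind with | _ u hu0
  induction q using Projectivization.ind with | _ v hv0
  induction r using Projectivization.ind with | _ w hw0
  rw [mk_mem_boundary] at hp hq hr
  have h1 := herm_ne_zero_of_mk_ne hu0 hv0 hp hq hpq
  have h2 := herm_ne_zero_of_mk_ne hv0 hw0 hq hr hqr
  have h3 := herm_ne_zero_of_mk_ne hw0 hu0 hr hp hrp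
  have h1' : herm v u ≠ 0 := by rwa [← conj_herm, Ne, map_eq_zero]
  have h2' : herm w v ≠ 0 := by rwa [← conj_herm, Ne, map_eq_zero]
  obtain ⟨A, hU, hA3, ht, ⟨a, ha⟩, ⟨b, hb⟩, ⟨c, hc⟩⟩ :=
    exists_unitary_cycle (u := (herm u v)⁻¹ • u) (v := v) (w := (herm w v)⁻¹ • w)
      (by simp [herm_smul_left, herm_smul_right, hp]) hq
      (by simp [herm_smul_left, herm_smul_right, hr])
      (by rw [herm_smul_right, map_inv₀, conj_herm, inv_mul_cancel₀ h1'])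
      (by rw [herm_smul_left, inv_mul_cancel₀ h2'])
      (by simp [herm_smul_left, herm_smul_right, h1, h2', h3])
  have hmem : hU.toGL ∈ U21 := hU
  let J : PU21 := ⟨Matrix.ProjGenLinGroup.mk hU.toGL, hU.toGL, hmem, rfl⟩
  have hJ : Matrix.ProjGenLinGroup.mk hU.toGL = (J : PGL(3, ℂ)) := rfl
  refine ⟨J, (isRegularElliptic_orderOf_iff hmem hJ).mpr ⟨hA3, ht⟩,
    (smul_mk_eq_mk_iff hmem hJ _ _).mpr ⟨herm u v * a, ?_⟩,
    (smul_mk_eq_mk_iff hmem hJ _ _).mpr ⟨b * (herm w v)⁻¹, ?_⟩,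
    (smul_mk_eq_mk_iff hmem hJ _ _).mpr ⟨herm w v * (c * (herm u v)⁻¹), ?_⟩⟩
  · change A *ᵥ u = _
    rw [mulVec_smul, inv_smul_eq_iff₀ h1] at ha
    rw [ha, smul_smul]
  · change A *ᵥ v = _
    rw [hb, smul_smul]
  · change A *ᵥ w = _
    rw [mulVec_smul, inv_smul_eq_iff₀ h2', smul_smul, smul_smul] at hc
    rw [hc, mul_assoc]

/-- The rotation of order three of an ideal triangle is unique. -/
lemma unitary_cycle_unique {u v w : V} (hu : herm u u = 0) (hv : herm v v = 0)
    (huv : herm u v = 1) (hvw : herm v w ≠ 0) (hwu : herm w u ≠ 0)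
    {A B : Matrix (Fin 3) (Fin 3) ℂ} (hA : IsUnitary A) (hB : IsUnitary B) (hAt : A.trace = 0)
    (hBt : B.trace = 0) {a b c a' b' c' : ℂ} (hAu : A *ᵥ u = a • v) (hAv : A *ᵥ v = b • w)
    (hAw : A *ᵥ w = c • u) (hBu : B *ᵥ u = a' • v) (hBv : B *ᵥ v = b' • w)
    (hBw : B *ᵥ w = c' • u) : ∃ s : ℂ, s ≠ 0 ∧ A = s • B := by
  have e1 : a * conj b * herm v w = 1 := by
    rw [← huv, ← hA u v, hAu, hAv, herm_smul_left, herm_smul_right]; ring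
  have e1' : a' * conj b' * herm v w = 1 := by
    rw [← huv, ← hB u v, hBu, hBv, herm_smul_left, herm_smul_right]; ring
  have e2 : b * conj c * herm w u = herm v w := by
    rw [← hA v w, hAv, hAw, herm_smul_left, herm_smul_right]; ring
  have e2' : b' * conj c' * herm w u = herm v w := by
    rw [← hB v w, hBv, hBw, herm_smul_left, herm_smul_right]; ring
  have e3 : c * conj a = herm w u := by
    rw [← hA w u, hAw, hAu, herm_smul_left, herm_smul_right, huv]; ring
  have e3' : c' * conj a' = herm w u := by
    rw [← hB w u, hBw, hBu, herm_smul_left, herm_smul_right, huv]; ring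
  have ha : a ≠ 0 := by rintro rfl; simp at e1
  have ha' : a' ≠ 0 := by rintro rfl; simp at e1'
  have hb' : b' ≠ 0 := by rintro rfl; simp at e1'
  have hc' : c' ≠ 0 := by rintro rfl; simp at e3'; exact hwu e3'.symm
  have f1 : a / a' * conj (b / b') = 1 := by
    have : a' * conj b' ≠ 0 := left_ne_zero_of_mul_eq_one e1'
    rw [map_div₀, div_mul_div_comm, div_eq_one_iff_eq this]
    exact mul_right_cancel₀ hvw (e1.trans e1'.symm)
  have f2 : b / b' * conj (c / c') = 1 := by
    have : b' * conj c' ≠ 0 := mul_ne_zero hb' (by simpa using hc')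
    rw [map_div₀, div_mul_div_comm, div_eq_one_iff_eq this]
    exact mul_right_cancel₀ hwu (e2.trans e2'.symm)
  have f3 : c / c' * conj (a / a') = 1 := by
    have : c' * conj a' ≠ 0 := by rw [e3']; exact hwu
    rw [map_div₀, div_mul_div_comm, div_eq_one_iff_eq this, e3, e3']
  set s := a / a'
  set t := b / b'
  set q := c / c'
  have hs0 : s ≠ 0 := left_ne_zero_of_mul_eq_one f1
  have g1 : conj s * t = 1 := by simpa using congrArg conj f1
  have g3 : conj q * s = 1 := by simpa using congrArg conj f3
  have hts : t = s := by
    have : conj q ≠ 0 := left_ne_zero_of_mul_eq_one g3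
    exact mul_right_cancel₀ this (by linear_combination f2 - g3)
  have hss : s * conj s = 1 := by rw [hts] at g1; linear_combination g1
  have hqs : q = s := mul_right_cancel₀ (b := conj s) (by simpa using hs0) (f3.trans hss.symm)
  have has : a = s * a' := (div_mul_cancel₀ a ha').symm
  have hbs : b = s * b' := by rw [← hts]; exact (div_mul_cancel₀ b hb').symm
  have hcs : c = s * c' := by rw [← hqs]; exact (div_mul_cancel₀ c hc').symm
  refine ⟨s, hs0, ?_⟩
  have hDu : (A - s • B) *ᵥ u = 0 := by
    rw [sub_mulVec, smul_mulVec, hAu, hBu, smul_smul, has, sub_self]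
  have hDv : (A - s • B) *ᵥ v = 0 := by
    rw [sub_mulVec, smul_mulVec, hAv, hBv, smul_smul, hbs, sub_self]
  have horth (x y : V) (d d' : ℂ) (hd : d ≠ 0) (hdd : d = s * d') (hAx : A *ᵥ x = d • y)
      (hBx : B *ᵥ x = d' • y) (k : V) : herm ((A - s • B) *ᵥ k) y = 0 := by
    have h1 := hA k x
    have h2 := hB k x
    rw [hAx, herm_smul_right] at h1
    rw [hBx, herm_smul_right] at h2
    have : conj d * herm ((A - s • B) *ᵥ k) y = 0 := by
      rw [sub_mulVec, smul_mulVec, herm_sub_left, herm_smul_left, mul_sub, h1, hdd, map_mul]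
      linear_combination (- s * conj s) * h2 - herm k x * hss
    exact (mul_eq_zero.mp this).resolve_left (by simpa using hd)
  obtain ⟨n, t, hn, hN, h0⟩ := exists_rank_one hu hv huv hDu hDv
    (horth w u c c' (by rw [hcs]; exact mul_ne_zero hs0 hc') hcs hAw hBw)
    (horth u v a a' ha has hAu hBu)
  have := hN 1
  rw [Matrix.one_mul, trace_sub, trace_smul, hAt, hBt, smul_zero, sub_zero, one_mulVec, hn,
    mul_one] at this
  exact sub_eq_zero.mp (h0 this.symm)

/-- The lifts of a regular elliptic element of order three to `U(2,1)` have trace zero; this is the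
property of such elements which determines their action on triangles. -/
def IsTraceless (g : PU21) : Prop :=
  ∃ A ∈ U21, Matrix.ProjGenLinGroup.mk A = (g : PGL(3, ℂ)) ∧
    (A : Matrix (Fin 3) (Fin 3) ℂ).trace = 0

lemma isTraceless_of_isRegularElliptic {g : PU21} (h : IsRegularElliptic g ∧ orderOf g = 3) :
    IsTraceless g := by
  obtain ⟨A, hU, hA⟩ := exists_lift g
  exact ⟨A, hU, hA, ((isRegularElliptic_orderOf_iff hU hA).mp h).2⟩

lemma IsTraceless.conj {g : PU21} (h : IsTraceless g) (k : PU21) :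
    IsTraceless (k * g * k⁻¹) := by
  obtain ⟨A, hU, hA, ht⟩ := h
  obtain ⟨K, hK, hKk⟩ := exists_lift k
  refine ⟨K * A * K⁻¹, mul_mem (mul_mem hK hU) (inv_mem hK), by simp [hA, hKk], ?_⟩
  rw [Units.val_mul, trace_mul_comm, Units.val_mul, ← Matrix.mul_assoc, Units.inv_mul,
    Matrix.one_mul, ht]

lemma cyclicallyPermutes_unique {p q r : ℙ ℂ V} (hp : p ∈ boundary) (hq : q ∈ boundary)
    (hr : r ∈ boundary) (hpq : p ≠ q) (hqr : q ≠ r) (hrp : r ≠ p) {g h : PU21}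
    (hg : IsTraceless g) (hh : IsTraceless h) (hgc : CyclicallyPermutes g p q r)
    (hhc : CyclicallyPermutes h p q r) : g = h := by
  induction p using Projectivization.ind with | _ u hu0
  induction q using Projectivization.ind with | _ v hv0
  induction r using Projectivization.ind with | _ w hw0
  rw [mk_mem_boundary] at hp hq hr
  have h1 := herm_ne_zero_of_mk_ne hu0 hv0 hp hq hpq
  have h2 := herm_ne_zero_of_mk_ne hv0 hw0 hq hr hqr
  have h3 := herm_ne_zero_of_mk_ne hw0 hu0 hr hp hrp
  obtain ⟨A, hU, hA, hAt⟩ := hg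
  obtain ⟨B, hUB, hB, hBt⟩ := hh
  obtain ⟨g1, g2, g3⟩ := hgc
  obtain ⟨k1, k2, k3⟩ := hhc
  rw [smul_mk_eq_mk_iff hU hA] at g1 g2 g3
  rw [smul_mk_eq_mk_iff hUB hB] at k1 k2 k3
  obtain ⟨a, ha⟩ := g1
  obtain ⟨b, hb⟩ := g2
  obtain ⟨c, hc⟩ := g3
  obtain ⟨a', ha'⟩ := k1
  obtain ⟨b', hb'⟩ := k2
  obtain ⟨c', hc'⟩ := k3
  have hsm {X : Matrix (Fin 3) (Fin 3) ℂ} {d : ℂ} (h : X *ᵥ w = d • u) :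
      X *ᵥ w = (d * herm u v) • ((herm u v)⁻¹ • u) := by
    rw [h, smul_smul, mul_assoc, mul_inv_cancel₀ h1, mul_one]
  obtain ⟨s, hs, h⟩ := unitary_cycle_unique (u := (herm u v)⁻¹ • u) (v := v) (w := w)
    (a := (herm u v)⁻¹ * a) (a' := (herm u v)⁻¹ * a')
    (by simp [herm_smul_left, herm_smul_right, hp]) hq
    (by rw [herm_smul_left, inv_mul_cancel₀ h1]) h2 (by simp [herm_smul_right, h1, h3])
    hU hUB hAt hBt (by rw [mulVec_smul, ha, smul_smul]) hb (hsm hc)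
    (by rw [mulVec_smul, ha', smul_smul]) hb' (hsm hc')
  rw [← Subtype.coe_inj, ← hA, ← hB, mk_eq_coe_iff]
  exact ⟨s, hs, h⟩

/-! ### Projections on geodesics -/

lemma exists_remoteness_mk {z : V} (hz : z ≠ 0) : ∃ k : ℝ, 0 < k ∧ ∀ (y : V) (hy : y ≠ 0),
    remoteness (Projectivization.mk ℂ z hz) (Projectivization.mk ℂ y hy) =
      k * (‖herm z y‖ ^ 2 / (-(herm y y).re)) := by
  obtain ⟨a, ha⟩ := Projectivization.exists_smul_eq_mk_rep ℂ z hz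
  refine ⟨‖(a : ℂ)‖ ^ 2, pow_pos (norm_pos_iff.mpr a.ne_zero) 2, fun y hy => ?_⟩
  obtain ⟨b, hb⟩ := Projectivization.exists_smul_eq_mk_rep ℂ y hy
  have hb0 : ‖(b : ℂ)‖ ^ 2 ≠ 0 := pow_ne_zero 2 (norm_ne_zero_iff.mpr b.ne_zero)
  rw [remoteness, ← ha, ← hb, Units.smul_def, Units.smul_def, herm_smul_left, herm_smul_right,
    herm_smul_left, herm_smul_right, ← mul_assoc (b : ℂ), Complex.mul_conj,
    Complex.re_ofReal_mul, Complex.normSq_eq_norm_sq, norm_mul, norm_mul, RCLike.norm_conj,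
    mul_pow, mul_pow, ← mul_neg, mul_left_comm, mul_div_mul_left _ _ hb0, mul_div_assoc]

/-- The points of a geodesic in terms of lifts of its endpoints. -/
lemma mem_geodesic_iff {u v : V} (hu0 : u ≠ 0) (hv0 : v ≠ 0) (hu : herm u u = 0)
    (huv : herm u v = -1) {x : ℙ ℂ V} :
    x ∈ geodesic (Projectivization.mk ℂ u hu0) (Projectivization.mk ℂ v hv0) ↔
      ∃ r : ℝ, 0 < r ∧ ∃ h : (r : ℂ) • u + (r : ℂ)⁻¹ • v ≠ 0, x = Projectivization.mk ℂ _ h := by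
  have hne (r : ℝ) (hr : 0 < r) : (r : ℂ) • u + (r : ℂ)⁻¹ • v ≠ 0 := by
    intro h
    have h' := congrArg (herm u) h
    rw [herm_add_right, herm_smul_right, herm_smul_right, hu, huv, herm_zero_right] at h'
    simp [hr.ne'] at h'
  constructor
  · rintro ⟨v', w', hv', hw', h, h1, h2, h3, rfl⟩
    obtain ⟨a, rfl⟩ := (Projectivization.mk_eq_mk_iff' ..).mp h1
    obtain ⟨b, rfl⟩ := (Projectivization.mk_eq_mk_iff' ..).mp h2
    rw [herm_smul_left, herm_smul_right, huv] at h3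
    have hab : a * conj b = 1 := by linear_combination -h3
    have ha : a ≠ 0 := left_ne_zero_of_mul_eq_one hab
    have hr : 0 < ‖a‖ := norm_pos_iff.mpr ha
    refine ⟨‖a‖, hr, hne _ hr, ?_⟩
    rw [Projectivization.mk_eq_mk_iff']
    have hr' : (‖a‖ : ℂ) ≠ 0 := by exact_mod_cast hr.ne'
    refine ⟨a / ‖a‖, ?_⟩
    have hba : b * conj a = 1 := by simpa [mul_comm] using congrArg conj hab
    have haa : a * conj a = (‖a‖ : ℂ) ^ 2 := by
      rw [Complex.mul_conj, Complex.normSq_eq_norm_sq]; simp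
    have hb : b = a / ‖a‖ * (‖a‖ : ℂ)⁻¹ := by
      field_simp
      rw [← haa]
      linear_combination a * hba
    rw [smul_add, smul_smul, smul_smul, ← hb, div_mul_cancel₀ _ hr']
  · rintro ⟨r, hr, h, rfl⟩
    have hr' : (r : ℂ) ≠ 0 := by exact_mod_cast hr.ne'
    refine ⟨(r : ℂ) • u, (r : ℂ)⁻¹ • v, smul_ne_zero hr' hu0, smul_ne_zero (inv_ne_zero hr') hv0, h,
      (Projectivization.mk_eq_mk_iff' ..).mpr ⟨r, rfl⟩,
      (Projectivization.mk_eq_mk_iff' ..).mpr ⟨(r : ℂ)⁻¹, rfl⟩, ?_, rfl⟩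
    rw [herm_smul_left, herm_smul_right, huv, map_inv₀, Complex.conj_ofReal]
    field_simp

/-- The orthogonal projection of an ideal point on a geodesic. -/
lemma isOrthogonalProjection_iff {u v z : V} (hu0 : u ≠ 0) (hv0 : v ≠ 0) (hz0 : z ≠ 0)
    (hu : herm u u = 0) (hv : herm v v = 0) (huv : herm u v = -1) (hzu : herm z u ≠ 0)
    (hzv : herm z v ≠ 0) {x : ℙ ℂ V} :
    IsOrthogonalProjection (Projectivization.mk ℂ u hu0) (Projectivization.mk ℂ v hv0)
        (Projectivization.mk ℂ z hz0) x ↔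
      ∃ r : ℝ, 0 < r ∧ r * ‖herm z u‖ = r⁻¹ * ‖herm z v‖ ∧
        ∃ h : (r : ℂ) • u + (r : ℂ)⁻¹ • v ≠ 0, x = Projectivization.mk ℂ _ h := by
  obtain ⟨k, hk, hrem⟩ := exists_remoteness_mk hz0
  have hvu : herm v u = -1 := by rw [← conj_herm, huv, map_neg, map_one]
  have hval (r : ℝ) (hr : 0 < r) (h : (r : ℂ) • u + (r : ℂ)⁻¹ • v ≠ 0) :
      remoteness (Projectivization.mk ℂ z hz0) (Projectivization.mk ℂ _ h) =
        k / 2 * ((r * ‖herm z u‖ - r⁻¹ * ‖herm z v‖) ^ 2 +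
          2 * (‖herm z u‖ * ‖herm z v‖ + (herm z u * conj (herm z v)).re)) := by
    have hr' : (r : ℂ) ≠ 0 := by exact_mod_cast hr.ne'
    rw [hrem]
    have h1 : herm ((r : ℂ) • u + (r : ℂ)⁻¹ • v) ((r : ℂ) • u + (r : ℂ)⁻¹ • v) = -2 := by
      simp only [herm_add_left, herm_add_right, herm_smul_left, herm_smul_right, hu, hv, huv, hvu,
        map_inv₀, Complex.conj_ofReal]
      field_simp
      ring
    have h2 : ‖herm z ((r : ℂ) • u + (r : ℂ)⁻¹ • v)‖ ^ 2 =
        (r * ‖herm z u‖) ^ 2 + (r⁻¹ * ‖herm z v‖) ^ 2 +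
          2 * (herm z u * conj (herm z v)).re := by
      simp only [herm_add_right, herm_smul_right, map_inv₀, Complex.conj_ofReal]
      rw [← Complex.normSq_eq_norm_sq, Complex.normSq_add, mul_pow, mul_pow,
        ← Complex.normSq_eq_norm_sq, ← Complex.normSq_eq_norm_sq, ← Complex.ofReal_inv,
        Complex.normSq_mul, Complex.normSq_mul, Complex.normSq_ofReal, Complex.normSq_ofReal,
        map_mul, Complex.conj_ofReal,
        show (r : ℂ) * herm z u * (((r⁻¹ : ℝ) : ℂ) * conj (herm z v)) =
          ((r * r⁻¹ : ℝ) : ℂ) * (herm z u * conj (herm z v)) by push_cast; ring,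
        mul_inv_cancel₀ hr.ne']
      simp
      ring
    rw [h1, h2]
    have : r * r⁻¹ = 1 := mul_inv_cancel₀ hr.ne'
    simp only [Complex.neg_re, Complex.re_ofNat, neg_neg]
    linear_combination k * ‖herm z u‖ * ‖herm z v‖ * this
  have ha : 0 < ‖herm z u‖ := norm_pos_iff.mpr hzu
  have hb : 0 < ‖herm z v‖ := norm_pos_iff.mpr hzv
  constructor
  · rintro ⟨hx, hmin⟩
    obtain ⟨r, hr, h, rfl⟩ := (mem_geodesic_iff hu0 hv0 hu huv).mp hx
    refine ⟨r, hr, ?_, h, rfl⟩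
    set s := √(‖herm z v‖ / ‖herm z u‖)
    have hs : 0 < s := Real.sqrt_pos.mpr (by positivity)
    have hs2 : s ^ 2 = ‖herm z v‖ / ‖herm z u‖ := Real.sq_sqrt (by positivity)
    have hseq : s * ‖herm z u‖ = s⁻¹ * ‖herm z v‖ := by
      rw [eq_inv_mul_iff_mul_eq₀ hs.ne', ← mul_assoc, ← pow_two, hs2, div_mul_cancel₀ _ ha.ne']
    have hs' : (s : ℂ) • u + (s : ℂ)⁻¹ • v ≠ 0 := by
      intro h
      have h' := congrArg (herm u) h
      rw [herm_add_right, herm_smul_right, herm_smul_right, hu, huv, herm_zero_right] at h'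
      simp [hs.ne'] at h'
    have := hmin _ ((mem_geodesic_iff hu0 hv0 hu huv).mpr ⟨s, hs, hs', rfl⟩)
    rw [hval r hr, hval s hs, hseq, sub_self, mul_le_mul_iff_right₀ (half_pos hk)] at this
    have h0 : (r * ‖herm z u‖ - r⁻¹ * ‖herm z v‖) ^ 2 = 0 :=
      le_antisymm (by linarith) (sq_nonneg _)
    exact sub_eq_zero.mp (pow_eq_zero_iff two_ne_zero |>.mp h0)
  · rintro ⟨r, hr, heq, h, rfl⟩
    refine ⟨(mem_geodesic_iff hu0 hv0 hu huv).mpr ⟨r, hr, h, rfl⟩, fun y hy => ?_⟩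
    obtain ⟨s, hs, h', rfl⟩ := (mem_geodesic_iff hu0 hv0 hu huv).mp hy
    rw [hval r hr, hval s hs, heq, sub_self, mul_le_mul_iff_right₀ (half_pos hk)]
    linarith [sq_nonneg (s * ‖herm z u‖ - s⁻¹ * ‖herm z v‖)]

lemma exists_common_projection_iff {u v z w : V} (hu0 : u ≠ 0) (hv0 : v ≠ 0) (hz0 : z ≠ 0)
    (hw0 : w ≠ 0) (hu : herm u u = 0) (hv : herm v v = 0) (huv : herm u v = -1)
    (hzu : herm z u ≠ 0) (hzv : herm z v ≠ 0) (hwu : herm w u ≠ 0) (hwv : herm w v ≠ 0) :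
    (∃ x, IsOrthogonalProjection (Projectivization.mk ℂ u hu0) (Projectivization.mk ℂ v hv0)
        (Projectivization.mk ℂ z hz0) x ∧
      IsOrthogonalProjection (Projectivization.mk ℂ u hu0) (Projectivization.mk ℂ v hv0)
        (Projectivization.mk ℂ w hw0) x) ↔
      ‖herm z u‖ * ‖herm w v‖ = ‖herm z v‖ * ‖herm w u‖ := by
  simp only [isOrthogonalProjection_iff hu0 hv0 hz0 hu hv huv hzu hzv,
    isOrthogonalProjection_iff hu0 hv0 hw0 hu hv huv hwu hwv]
  have hvu : herm v u = -1 := by rw [← conj_herm, huv, map_neg, map_one]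
  have ha : 0 < ‖herm z u‖ := norm_pos_iff.mpr hzu
  have hb : 0 < ‖herm z v‖ := norm_pos_iff.mpr hzv
  constructor
  · rintro ⟨x, ⟨r, hr, hr1, hr', rfl⟩, s, hs, hs1, hs', heq⟩
    obtain ⟨c, hc⟩ := (Projectivization.mk_eq_mk_iff' ..).mp heq
    have h1 := congrArg (fun y => herm y v) hc
    have h2 := congrArg (fun y => herm y u) hc
    simp only [herm_add_left, herm_smul_left, hu, hv, huv, hvu] at h1 h2
    have hrs : (s : ℂ) ^ 2 = (r : ℂ) ^ 2 := by
      have hr0 : (r : ℂ) ≠ 0 := by exact_mod_cast hr.ne'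
      have hs0 : (s : ℂ) ≠ 0 := by exact_mod_cast hs.ne'
      have e1 : c * s = r := by linear_combination -h1
      have e2 : c * (s : ℂ)⁻¹ = (r : ℂ)⁻¹ := by linear_combination -h2
      have e3 : c * r = s := by field_simp at e2; exact e2
      linear_combination (-s) * e3 + r * e1
    have hrs' : s = r := by
      have : s ^ 2 = r ^ 2 := by exact_mod_cast hrs
      exact (sq_eq_sq₀ hs.le hr.le).mp this
    subst hrs'
    have hs0 : s ≠ 0 := hs.ne'
    rw [eq_inv_mul_iff_mul_eq₀ hs0] at hr1 hs1
    rw [← hr1, ← hs1]; ring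
  · intro h
    set s := √(‖herm z v‖ / ‖herm z u‖)
    have hs : 0 < s := Real.sqrt_pos.mpr (by positivity)
    have hs2 : s ^ 2 = ‖herm z v‖ / ‖herm z u‖ := Real.sq_sqrt (by positivity)
    have hseq : s * ‖herm z u‖ = s⁻¹ * ‖herm z v‖ := by
      rw [eq_inv_mul_iff_mul_eq₀ hs.ne', ← mul_assoc, ← pow_two, hs2, div_mul_cancel₀ _ ha.ne']
    have hseq' : s * ‖herm w u‖ = s⁻¹ * ‖herm w v‖ := by
      rw [eq_inv_mul_iff_mul_eq₀ hs.ne', ← mul_assoc, ← pow_two, hs2]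
      field_simp
      linarith
    have hs_ne : (s : ℂ) • u + (s : ℂ)⁻¹ • v ≠ 0 := by
      intro h
      have h' := congrArg (herm u) h
      rw [herm_add_right, herm_smul_right, herm_smul_right, hu, huv, herm_zero_right] at h'
      simp [hs.ne'] at h'
    exact ⟨_, ⟨s, hs, hseq, hs_ne, rfl⟩, s, hs, hseq', hs_ne, rfl⟩

/-- Balanced tetrahedra in terms of lifts of the vertices. -/
lemma isBalanced_iff {τ : Fin 4 → ℙ ℂ V} {u v z w : V} (hu0 : u ≠ 0) (hv0 : v ≠ 0) (hz0 : z ≠ 0)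
    (hw0 : w ≠ 0) (h0 : τ 0 = Projectivization.mk ℂ u hu0) (h1 : τ 1 = Projectivization.mk ℂ v hv0)
    (h2 : τ 2 = Projectivization.mk ℂ z hz0) (h3 : τ 3 = Projectivization.mk ℂ w hw0)
    (hu : herm u u = 0) (hv : herm v v = 0) (huv : herm u v ≠ 0)
    (hzu : herm z u ≠ 0) (hzv : herm z v ≠ 0) (hwu : herm w u ≠ 0) (hwv : herm w v ≠ 0) :
    IsBalanced τ ↔ ‖herm z u‖ * ‖herm w v‖ = ‖herm z v‖ * ‖herm w u‖ := by
  set a := -(herm u v)⁻¹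
  have ha : a ≠ 0 := neg_ne_zero.mpr (inv_ne_zero huv)
  have hau : a • u ≠ 0 := smul_ne_zero ha hu0
  have hmk : Projectivization.mk ℂ u hu0 = Projectivization.mk ℂ (a • u) hau :=
    ((Projectivization.mk_eq_mk_iff' ..).mpr ⟨a, rfl⟩).symm
  rw [IsBalanced, h0, h1, h2, h3, hmk, exists_common_projection_iff hau hv0 hz0 hw0
    (by simp [herm_smul_left, herm_smul_right, hu]) hv
    (by rw [herm_smul_left, neg_mul, inv_mul_cancel₀ huv])
    (by simp [herm_smul_right, ha, hzu]) hzv (by simp [herm_smul_right, ha, hwu]) hwv,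
    herm_smul_right, herm_smul_right, norm_mul, norm_mul, mul_assoc, mul_left_comm ‖herm z v‖]
  exact mul_right_inj' (by simpa using ha)

/-! ### Products of two rotations -/

lemma IsUnitary.norm_cycle {A : Matrix (Fin 3) (Fin 3) ℂ} (hA : IsUnitary A) {x y z : V}
    {a b c : ℂ} (hx : A *ᵥ x = a • y) (hy : A *ᵥ y = b • z) (hz : A *ᵥ z = c • x)
    (hxy : herm x y ≠ 0) (hyz : herm y z ≠ 0) : ‖a‖ * ‖herm y z‖ = ‖herm z x‖ := by
  have e1 := congrArg norm (hA x y)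
  have e2 := congrArg norm (hA y z)
  have e3 := congrArg norm (hA z x)
  rw [hx, hy, herm_smul_left, herm_smul_right, norm_mul, norm_mul, RCLike.norm_conj] at e1
  rw [hy, hz, herm_smul_left, herm_smul_right, norm_mul, norm_mul, RCLike.norm_conj] at e2
  rw [hz, hx, herm_smul_left, herm_smul_right, norm_mul, norm_mul, RCLike.norm_conj] at e3
  have hp := norm_pos_iff.mpr hxy
  have hq := norm_pos_iff.mpr hyz
  rw [← sq_eq_sq₀ (by positivity) (by positivity)]
  calc (‖a‖ * ‖herm y z‖) ^ 2 = ‖a‖ * (‖a‖ * ‖herm y z‖) * ‖herm y z‖ := by ring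
    _ = ‖a‖ * (‖a‖ * ‖herm y z‖) * (‖b‖ * (‖c‖ * ‖herm z x‖)) := by rw [e2]
    _ = ‖c‖ * (‖a‖ * (‖a‖ * (‖b‖ * ‖herm y z‖))) * ‖herm z x‖ := by ring
    _ = ‖herm z x‖ ^ 2 := by rw [e1, e3, pow_two]

/-- An eigenvalue off the unit circle has a companion. -/
lemma IsUnitary.exists_eigenvector {C : Matrix (Fin 3) (Fin 3) ℂ} (hC : IsUnitary C) {u : V}
    {l : ℂ} (hu0 : u ≠ 0) (hu : C *ᵥ u = l • u) (hl : l ≠ 0) (hl1 : ‖l‖ ≠ 1) :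
    ∃ y : V, y ≠ 0 ∧ herm y y = 0 ∧ (∀ a : ℂ, y ≠ a • u) ∧ ∃ m : ℂ, C *ᵥ y = m • y := by
  have hd : (C - l • 1).det = 0 := by
    rw [← exists_mulVec_eq_zero_iff]
    exact ⟨u, hu0, by rw [sub_mulVec, smul_mulVec, one_mulVec, hu, sub_self]⟩
  have hd' : (adj (C - l • 1)).det = 0 := by
    rw [adj, det_mul, det_mul, det_conjTranspose, hd]; simp
  have hadj : adj (C - l • 1) = adj C - conj l • 1 := by
    simp only [adj, conjTranspose_sub, conjTranspose_smul, conjTranspose_one, Matrix.mul_sub,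
      Matrix.sub_mul, Matrix.mul_smul, Matrix.smul_mul, Matrix.mul_one, gram_mul_gram]
    rfl
  rw [hadj, ← exists_mulVec_eq_zero_iff] at hd'
  obtain ⟨y, hy0, hy⟩ := hd'
  rw [sub_mulVec, smul_mulVec, one_mulVec, sub_eq_zero] at hy
  have hl' : conj l ≠ 0 := by simpa using hl
  have hCy : C *ᵥ y = (conj l)⁻¹ • y := by
    rw [eq_inv_smul_iff₀ hl', ← mulVec_smul, ← hy, mulVec_mulVec, hC.mul_adj, one_mulVec]
  have hll : l * conj l ≠ 1 := by
    intro h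
    apply hl1
    rw [Complex.mul_conj, Complex.normSq_eq_norm_sq] at h
    exact (pow_eq_one_iff_of_nonneg (norm_nonneg _) two_ne_zero).mp (by exact_mod_cast h)
  refine ⟨y, hy0, ?_, ?_, _, hCy⟩
  · have h := hC y y
    rw [hCy, herm_smul_left, herm_smul_right, map_inv₀, Complex.conj_conj] at h
    by_contra h0
    apply hll
    field_simp at h
    rw [mul_comm, ← h]
  · rintro a rfl
    have ha : a ≠ 0 := by rintro rfl; simp at hy0
    rw [mulVec_smul, hu, smul_comm] at hCy
    have h1 := smul_left_injective ℂ (smul_ne_zero ha hu0) hCy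
    refine hll ?_
    nth_rw 1 [h1]
    exact inv_mul_cancel₀ (by simpa using hl)

/-- If the product of two rotations of order three fixes an ideal point with a unit eigenvalue, and
has another fixed point in the closed complex hyperbolic plane, then it is scalar. -/
lemma mul_eq_smul_one_of_fixed {A B : Matrix (Fin 3) (Fin 3) ℂ} {c l m : ℂ} (hA : IsUnitary A)
    (hB : IsUnitary B) (hA3 : A ^ 3 = c • 1) (hAt : A.trace = 0) (hBt : B.trace = 0) {u x : V}
    (hu : herm u u = 0) (hux : herm u x ≠ 0) (hl : ‖l‖ = 1) (hCu : (A * B) *ᵥ u = l • u)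
    (hCx : (A * B) *ᵥ x = m • x) : A * B = l • 1 := by
  have hC := hA.mul hB
  have hll : l * conj l = 1 := by
    rw [Complex.mul_conj, Complex.normSq_eq_norm_sq, hl]; simp
  have hl0 : conj l ≠ 0 := right_ne_zero_of_mul_eq_one hll
  have hxu : herm x u ≠ 0 := by rwa [← conj_herm, Ne, map_eq_zero]
  have hml : m = l := by
    have h := hC x u
    rw [hCu, hCx, herm_smul_left, herm_smul_right] at h
    have : m * conj l = 1 := mul_right_cancel₀ hxu (by linear_combination h)
    exact mul_right_cancel₀ hl0 (this.trans hll.symm)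
  subst hml
  obtain ⟨t, ht⟩ : ∃ t, t * herm u x = herm x x / 2 :=
    ⟨herm x x / 2 / herm u x, div_mul_cancel₀ _ hux⟩
  set y := (conj (herm u x))⁻¹ • (x - t • u) with hy
  have huy : herm u y = 1 := by
    rw [hy, herm_smul_right, herm_sub_right, herm_smul_right, hu, map_inv₀, Complex.conj_conj,
      mul_zero, sub_zero, inv_mul_cancel₀ hux]
  have hyy : herm y y = 0 := by
    have ht' : conj t * herm x u = herm x x / 2 := by
      have := congrArg conj ht
      rwa [map_mul, conj_herm, map_div₀, conj_herm, Complex.conj_ofNat] at this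
    have : herm (x - t • u) (x - t • u) = 0 := by
      rw [herm_sub_left, herm_sub_right, herm_sub_right, herm_smul_left, herm_smul_left,
        herm_smul_right, herm_smul_right, hu]
      linear_combination -ht - ht'
    rw [hy, herm_smul_left, herm_smul_right, this, mul_zero, mul_zero]
  have hCy : (A * B) *ᵥ y = m • y := by
    rw [hy, mulVec_smul, mulVec_sub, mulVec_smul, hCx, hCu]
    module
  have hD {v : V} (hv : (A * B) *ᵥ v = m • v) : (A * B - m • 1) *ᵥ v = 0 := by
    rw [sub_mulVec, smul_mulVec, one_mulVec, hv, sub_self]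
  have horth {v : V} (hv : (A * B) *ᵥ v = m • v) (k : V) :
      herm ((A * B - m • 1) *ᵥ k) v = 0 := by
    have h := hC k v
    rw [hv, herm_smul_right] at h
    rw [sub_mulVec, smul_mulVec, one_mulVec, herm_sub_left, herm_smul_left]
    linear_combination m * h - herm ((A * B) *ᵥ k) v * hll
  obtain ⟨n, s, hn, hN, hs0⟩ := exists_rank_one hu hyy huy (hD hCu) (hD hCy) (horth hCu) (horth hCy)
  have htr := hN (adj A)
  rw [Matrix.mul_sub, ← Matrix.mul_assoc, hA.adj_mul, Matrix.one_mul, Matrix.mul_smul,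
    Matrix.mul_one, trace_sub, trace_smul, trace_adj, hAt, hBt, map_zero, smul_zero, sub_zero,
    eq_comm, mul_eq_zero] at htr
  rcases htr with hs | hs
  · exact sub_eq_zero.mp (hs0 hs)
  · rw [← herm_mulVec_right] at hs
    exfalso
    refine not_three_orthonormal hn (y := A *ᵥ n) (z := A *ᵥ A *ᵥ n) ?_ ?_ hs ?_ ?_
    · rw [hA, hn]
    · rw [hA, hA, hn]
    · rw [← hA, pow_three_mulVec hA3, herm_smul_right, herm_comm_eq_zero hs, mul_zero]
    · rw [hA, hs]

/-! ### Tetrahedra and pairs of rotations -/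

lemma smul_mem_boundary (g : PU21) {x : ℙ ℂ V} (hx : x ∈ boundary) : g • x ∈ boundary := by
  obtain ⟨A, hU, hA⟩ := exists_lift g
  induction x using Projectivization.ind with | _ v hv
  rw [smul_mk_eq hA hv ((mem_U21_iff.mp hU).mulVec_ne_zero hv), mk_mem_boundary]
  rw [mk_mem_boundary] at hx
  rw [mem_U21_iff.mp hU, hx]

/-- A regular elliptic element of order three has no fixed point on the boundary. -/
lemma smul_ne_of_mem_boundary {g : PU21} (h : IsRegularElliptic g ∧ orderOf g = 3) {x : ℙ ℂ V}
    (hx : x ∈ boundary) : g • x ≠ x := by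
  intro hgx
  obtain ⟨A, hU, hA⟩ := exists_lift g
  obtain ⟨⟨c, hA3⟩, hAt⟩ := (isRegularElliptic_orderOf_iff hU hA).mp h
  obtain ⟨y, hy, hgy⟩ := h.1.1
  induction x using Projectivization.ind with | _ u hu0
  induction y using Projectivization.ind with | _ v hv0
  rw [mk_mem_boundary] at hx
  rw [mk_mem_hyperbolicPlane] at hy
  rw [smul_mk_eq_mk_iff hU hA] at hgx hgy
  obtain ⟨l, hl⟩ := hgx
  obtain ⟨m, hm⟩ := hgy
  rw [mem_U21_iff] at hU
  have huv : herm u v ≠ 0 := by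
    intro h0
    obtain ⟨a, rfl⟩ := exists_eq_smul_of_herm_eq_zero hu0 hx hy.le (herm_comm_eq_zero h0)
    rw [herm_smul_left, herm_smul_right, hx] at hy
    simp at hy
  have hsq {w : V} {k : ℂ} (hw : A.1 *ᵥ w = k • w) : (A.1 * A.1) *ᵥ w = (k * k) • w := by
    rw [← mulVec_mulVec, hw, mulVec_smul, hw, smul_smul]
  have hc := hU.pow_three_scalar hA3
  have hlc : l ^ 3 = c := by
    have h3 := pow_three_mulVec hA3 u
    rw [hl, mulVec_smul, hl, mulVec_smul, mulVec_smul, hl, smul_smul, smul_smul] at h3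
    rw [← smul_left_injective ℂ hu0 h3]; ring
  have hl1 : ‖l‖ = 1 := by
    rw [Complex.mul_conj, Complex.normSq_eq_norm_sq] at hc
    have hc1 : ‖c‖ ^ 2 = 1 := by exact_mod_cast hc
    have hc2 := (pow_eq_one_iff_of_nonneg (norm_nonneg _) two_ne_zero).mp hc1
    rw [← hlc, norm_pow] at hc2
    exact (pow_eq_one_iff_of_nonneg (norm_nonneg _) three_ne_zero).mp hc2
  have hs := mul_eq_smul_one_of_fixed (l := l * l) hU hU hA3 hAt hAt hx huv
    (by rw [norm_mul, hl1, one_mul]) (hsq hl) (hsq hm)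
  rw [pow_three, hs, Matrix.mul_smul, Matrix.mul_one] at hA3
  have ht := congrArg trace hA3
  rw [trace_smul, hAt, smul_zero, trace_smul, trace_one] at ht
  exact hU.pow_three_scalar_ne_zero (M := A.1) (c := c)
    (by rw [pow_three, hs, Matrix.mul_smul, Matrix.mul_one, hA3]) (by simpa using ht)

/-- The product of the rotations attached to a tetrahedron is parabolic exactly when the tetrahedron
is balanced. -/
lemma isParabolic_iff_isBalanced {τ : Fin 4 → ℙ ℂ V} (hτ : ∀ i, τ i ∈ boundary)
    (hinj : Function.Injective τ) {J : PU21 × PU21} (h1 : IsRegularElliptic J.1 ∧ orderOf J.1 = 3)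
    (h2 : IsRegularElliptic J.2 ∧ orderOf J.2 = 3) (hJ : IsAttached τ J) :
    IsParabolic (J.1 * J.2) ↔ IsBalanced τ := by
  obtain ⟨A, hUA, hA⟩ := exists_lift J.1
  obtain ⟨B, hUB, hB⟩ := exists_lift J.2
  obtain ⟨⟨c, hA3⟩, hAt⟩ := (isRegularElliptic_orderOf_iff hUA hA).mp h1
  obtain ⟨-, hBt⟩ := (isRegularElliptic_orderOf_iff hUB hB).mp h2
  have hUAB : A * B ∈ U21 := mul_mem hUA hUB
  have hAB : Matrix.ProjGenLinGroup.mk (A * B) = ((J.1 * J.2 : PU21) : PGL(3, ℂ)) := by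
    rw [map_mul, hA, hB]; rfl
  have hex (i : Fin 4) : ∃ (x : V) (hx : x ≠ 0), τ i = Projectivization.mk ℂ x hx :=
    ⟨_, _, (Projectivization.mk_rep (τ i)).symm⟩
  obtain ⟨u, hu0, e0⟩ := hex 0
  obtain ⟨v, hv0, e1⟩ := hex 1
  obtain ⟨z, hz0, e2⟩ := hex 2
  obtain ⟨w, hw0, e3⟩ := hex 3
  have hu : herm u u = 0 := by simpa [e0, mk_mem_boundary] using hτ 0
  have hv : herm v v = 0 := by simpa [e1, mk_mem_boundary] using hτ 1
  have hz : herm z z = 0 := by simpa [e2, mk_mem_boundary] using hτ 2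
  have hw : herm w w = 0 := by simpa [e3, mk_mem_boundary] using hτ 3
  have huv : herm u v ≠ 0 := herm_ne_zero_of_mk_ne hu0 hv0 hu hv
    (by rw [← e0, ← e1]; exact hinj.ne (by decide))
  have hvu : herm v u ≠ 0 := herm_ne_zero_of_mk_ne hv0 hu0 hv hu
    (by rw [← e0, ← e1]; exact hinj.ne (by decide))
  have huz : herm u z ≠ 0 := herm_ne_zero_of_mk_ne hu0 hz0 hu hz
    (by rw [← e0, ← e2]; exact hinj.ne (by decide))
  have hvw : herm v w ≠ 0 := herm_ne_zero_of_mk_ne hv0 hw0 hv hw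
    (by rw [← e1, ← e3]; exact hinj.ne (by decide))
  have hzu : herm z u ≠ 0 := herm_ne_zero_of_mk_ne hz0 hu0 hz hu
    (by rw [← e0, ← e2]; exact hinj.ne (by decide))
  have hzv : herm z v ≠ 0 := herm_ne_zero_of_mk_ne hz0 hv0 hz hv
    (by rw [← e1, ← e2]; exact hinj.ne (by decide))
  have hwu : herm w u ≠ 0 := herm_ne_zero_of_mk_ne hw0 hu0 hw hu
    (by rw [← e0, ← e3]; exact hinj.ne (by decide))
  have hwv : herm w v ≠ 0 := herm_ne_zero_of_mk_ne hw0 hv0 hw hv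
    (by rw [← e1, ← e3]; exact hinj.ne (by decide))
  rw [isBalanced_iff hu0 hv0 hz0 hw0 e0 e1 e2 e3 hu hv huv hzu hzv hwu hwv]
  obtain ⟨⟨a1, a2, a3⟩, b1, b2, b3⟩ := hJ
  have hpar : IsParabolic (J.1 * J.2) → ∀ y, y ≠ 0 → herm y y = 0 → (∀ a : ℂ, y ≠ a • u) →
      ¬ ∃ m : ℂ, (A.1 * B.1) *ᵥ y = m • y := by
    rintro ⟨-, x, hx, hxu⟩ y hy0 hy hyu hm
    have f0 : (J.1 * J.2) • τ 0 = τ 0 := by rw [mul_smul, b1, a1]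
    have f1 := hxu _ ⟨hτ 0, f0⟩
    have f2 := hxu _ ⟨(mk_mem_boundary hy0).mpr hy, (smul_mk_eq_mk_iff hUAB hAB hy0 hy0).mpr hm⟩
    obtain ⟨a, ha⟩ := (Projectivization.mk_eq_mk_iff' ..).mp ((f2.trans f1.symm).trans e0)
    exact hyu a ha.symm
  have hfix {y : V} (hy0 : y ≠ 0)
      (h : (J.1 * J.2) • Projectivization.mk ℂ y hy0 = Projectivization.mk ℂ y hy0) :
      ∃ m : ℂ, (A.1 * B.1) *ᵥ y = m • y := (smul_mk_eq_mk_iff hUAB hAB hy0 hy0).mp h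
  have hne : Projectivization.mk ℂ z hz0 ≠ Projectivization.mk ℂ w hw0 := by
    rw [← e2, ← e3]; exact hinj.ne (by decide)
  have hzero := e0 ▸ hτ 0
  have hfix0 : (J.1 * J.2) • Projectivization.mk ℂ u hu0 = Projectivization.mk ℂ u hu0 := by
    rw [← e0, mul_smul, b1, a1]
  rw [e0, e1, smul_mk_eq_mk_iff hUA hA] at a1
  rw [e0, e2, smul_mk_eq_mk_iff hUA hA] at a2
  rw [e1, e2, smul_mk_eq_mk_iff hUA hA] at a3
  rw [e0, e1, smul_mk_eq_mk_iff hUB hB] at b1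
  rw [e1, e3, smul_mk_eq_mk_iff hUB hB] at b2
  rw [e0, e3, smul_mk_eq_mk_iff hUB hB] at b3
  obtain ⟨a, ha⟩ := a1
  obtain ⟨b, hb⟩ := a2
  obtain ⟨d, hd⟩ := a3
  obtain ⟨a', ha'⟩ := b1
  obtain ⟨b', hb'⟩ := b2
  obtain ⟨d', hd'⟩ := b3
  rw [mem_U21_iff] at hUA hUB
  have n1 := hUA.norm_cycle ha hb hd hvu huz
  have n2 := hUB.norm_cycle ha' hb' hd' huv hvw
  have hCu : (A.1 * B.1) *ᵥ u = (a' * a) • u := by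
    rw [← mulVec_mulVec, ha', mulVec_smul, ha, smul_smul]
  have ha0 : a ≠ 0 := by
    rintro rfl
    rw [norm_zero, zero_mul, eq_comm, norm_eq_zero] at n1
    exact hzv n1
  have ha'0 : a' ≠ 0 := by
    rintro rfl
    rw [norm_zero, zero_mul, eq_comm, norm_eq_zero] at n2
    exact hwu n2
  have hiff : ‖herm z u‖ * ‖herm w v‖ = ‖herm z v‖ * ‖herm w u‖ ↔ ‖a' * a‖ = 1 := by
    rw [← n1, ← n2, norm_herm_comm z u, norm_herm_comm w v, norm_mul,
      show ‖a‖ * ‖herm u z‖ * (‖a'‖ * ‖herm v w‖) =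
        (‖a'‖ * ‖a‖) * (‖herm u z‖ * ‖herm v w‖) by ring, eq_comm]
    exact mul_eq_right₀ (mul_ne_zero (norm_ne_zero_iff.mpr huz) (norm_ne_zero_iff.mpr hvw))
  rw [hiff]
  constructor
  · intro hp
    by_contra hl
    obtain ⟨y, hy0, hy, hyu, hm⟩ :=
      (hUA.mul hUB).exists_eigenvector hu0 hCu (mul_ne_zero ha'0 ha0) hl
    exact hpar hp y hy0 hy hyu hm
  · intro hl
    have hnofix (y : V) (hyy : (herm y y).re ≤ 0) (hyu : ∀ r : ℂ, y ≠ r • u) :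
        ¬ ∃ m : ℂ, (A.1 * B.1) *ᵥ y = m • y := by
      rintro ⟨m, hm⟩
      have huy : herm u y ≠ 0 := by
        intro h0
        obtain ⟨r, hr⟩ := exists_eq_smul_of_herm_eq_zero hu0 hu hyy (herm_comm_eq_zero h0)
        exact hyu r hr
      have hs := mul_eq_smul_one_of_fixed hUA hUB hA3 hAt hBt hu huy hl hCu hm
      have hw' : (A.1 * B.1) *ᵥ w = (d' * b) • z := by
        rw [← mulVec_mulVec, hd', mulVec_smul, hb, smul_smul]
      rw [hs, smul_mulVec, one_mulVec, ← eq_inv_smul_iff₀ (mul_ne_zero ha'0 ha0), smul_smul] at hw'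
      exact hne ((Projectivization.mk_eq_mk_iff' ..).mpr ⟨_, hw'.symm⟩).symm
    refine ⟨fun x hx hfx => ?_, Projectivization.mk ℂ u hu0, ⟨hzero, hfix0⟩, ?_⟩
    · induction x using Projectivization.ind with | _ y hy0
      rw [mk_mem_hyperbolicPlane] at hx
      refine hnofix y hx.le ?_ (hfix hy0 hfx)
      rintro r rfl
      rw [herm_smul_left, herm_smul_right, hu] at hx
      simp at hx
    · rintro x ⟨hx, hfx⟩
      induction x using Projectivization.ind with | _ y hy0
      rw [mk_mem_boundary] at hx
      by_contra hne'
      refine hnofix y (by rw [hx]; simp) ?_ (hfix hy0 hfx)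
      rintro r rfl
      exact hne' ((Projectivization.mk_eq_mk_iff' ..).mpr ⟨r, rfl⟩)

/-- Every balanced tetrahedron has an attached pair. -/
lemma exists_attached_pair (τ : BalancedTetrahedron) :
    ∃ J : Marked33InftyGroup, IsAttached τ.1 J.1 := by
  obtain ⟨τ, hτ, hinj, hbal⟩ := τ
  obtain ⟨J₁, h1, h1'⟩ := exists_cyclicallyPermutes (hτ 1) (hτ 0) (hτ 2)
    (hinj.ne (by decide)) (hinj.ne (by decide)) (hinj.ne (by decide))
  obtain ⟨J₂, h2, h2'⟩ := exists_cyclicallyPermutes (hτ 0) (hτ 1) (hτ 3)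
    (hinj.ne (by decide)) (hinj.ne (by decide)) (hinj.ne (by decide))
  exact ⟨⟨(J₁, J₂), h1, h2,
    (isParabolic_iff_isBalanced hτ hinj (J := (J₁, J₂)) h1 h2 ⟨h1', h2'⟩).mpr hbal⟩, h1', h2'⟩

lemma attached_pair_unique {τ : Fin 4 → ℙ ℂ V} (hτ : ∀ i, τ i ∈ boundary)
    (hinj : Function.Injective τ) {J K : PU21 × PU21} (hJ1 : IsTraceless J.1)
    (hJ2 : IsTraceless J.2) (hK1 : IsTraceless K.1) (hK2 : IsTraceless K.2)
    (hJ : IsAttached τ J) (hK : IsAttached τ K) : J = K :=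
  Prod.ext
    (cyclicallyPermutes_unique (hτ 1) (hτ 0) (hτ 2) (hinj.ne (by decide)) (hinj.ne (by decide))
      (hinj.ne (by decide)) hJ1 hK1 hJ.1 hK.1)
    (cyclicallyPermutes_unique (hτ 0) (hτ 1) (hτ 3) (hinj.ne (by decide)) (hinj.ne (by decide))
      (hinj.ne (by decide)) hJ2 hK2 hJ.2 hK.2)

lemma smul_smul_smul_eq {g : PU21} (h : orderOf g = 3) (x : ℙ ℂ V) : g • g • g • x = x := by
  rw [← mul_smul, ← mul_smul, ← pow_three', orderOf_dvd_iff_pow_eq_one.mp h.dvd, one_smul]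

/-- Every marked group is attached to a balanced tetrahedron. -/
lemma exists_attached_tetrahedron (J : Marked33InftyGroup) :
    ∃ τ : BalancedTetrahedron, IsAttached τ.1 J.1 := by
  obtain ⟨⟨g, h⟩, hg, hh, hp⟩ := J
  have hp' := hp
  obtain ⟨-, p, ⟨hpb, hpf⟩, hpu⟩ := hp
  simp only at hg hh hpf hpu hp'
  have hg3 := smul_smul_smul_eq hg.2
  have hh3 := smul_smul_smul_eq hh.2
  have hgh : g • h • p = p := by rw [← mul_smul]; exact hpf
  set τ : Fin 4 → ℙ ℂ V := ![p, h • p, g • p, h • h • p] with hτdef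
  have hatt : IsAttached τ (g, h) := by
    refine ⟨⟨hgh, rfl, ?_⟩, rfl, rfl, hh3 p⟩
    change g • g • p = h • p
    conv_lhs => rw [← hgh]
    exact hg3 _
  have hτ : ∀ i, τ i ∈ boundary := by
    intro i
    fin_cases i
    · exact hpb
    · exact smul_mem_boundary h hpb
    · exact smul_mem_boundary g hpb
    · exact smul_mem_boundary h (smul_mem_boundary h hpb)
  have n01 : p ≠ h • p := (smul_ne_of_mem_boundary hh hpb).symm
  have n02 : p ≠ g • p := (smul_ne_of_mem_boundary hg hpb).symm
  have n03 : p ≠ h • h • p := by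
    intro e
    apply smul_ne_of_mem_boundary hh hpb
    conv_lhs => rw [e]
    exact hh3 p
  have n12 : h • p ≠ g • p := by
    intro e
    have := hatt.1.2.2
    change g • g • p = h • p at this
    rw [e] at this
    exact smul_ne_of_mem_boundary hg (smul_mem_boundary g hpb) this
  have n13 : h • p ≠ h • h • p := (smul_ne_of_mem_boundary hh (smul_mem_boundary h hpb)).symm
  have n23 : g • p ≠ h • h • p := by
    intro e
    have : (g * h) • h • h • p = h • h • p := by rw [mul_smul, hh3, e]
    exact n03 (hpu _ ⟨hτ 3, this⟩).symm
  have hinj : Function.Injective τ := by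
    intro i j hij
    fin_cases i <;> fin_cases j <;> 
      first
      | rfl
      | exact absurd hij n01 | exact absurd hij n02 | exact absurd hij n03
      | exact absurd hij n12 | exact absurd hij n13 | exact absurd hij n23
      | exact absurd hij.symm n01 | exact absurd hij.symm n02 | exact absurd hij.symm n03
      | exact absurd hij.symm n12 | exact absurd hij.symm n13 | exact absurd hij.symm n23
  exact ⟨⟨τ, hτ, hinj, (isParabolic_iff_isBalanced hτ hinj hg hh hatt).mp hp'⟩, hatt⟩

lemma attached_tetrahedron_unique {τ σ : Fin 4 → ℙ ℂ V} (hτ : ∀ i, τ i ∈ boundary)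
    (hσ : ∀ i, σ i ∈ boundary) {J : PU21 × PU21} (hJ : IsParabolic (J.1 * J.2))
    (hτJ : IsAttached τ J) (hσJ : IsAttached σ J) : τ = σ := by
  have h0 : τ 0 = σ 0 := by
    obtain ⟨x, -, hx⟩ := hJ.2
    rw [hx (τ 0) ⟨hτ 0, by rw [mul_smul, hτJ.2.1, hτJ.1.1]⟩,
      hx (σ 0) ⟨hσ 0, by rw [mul_smul, hσJ.2.1, hσJ.1.1]⟩]
  have h1 : τ 1 = σ 1 := by rw [← hτJ.2.1, ← hσJ.2.1, h0]
  funext i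
  fin_cases i
  · exact h0
  · exact h1
  · change τ 2 = σ 2
    rw [← hτJ.1.2.1, ← hσJ.1.2.1, h0]
  · change τ 3 = σ 3
    rw [← hτJ.2.2.1, ← hσJ.2.2.1, h1]

lemma CyclicallyPermutes.conj {g : PU21} {p q r : ℙ ℂ V} (h : CyclicallyPermutes g p q r)
    (k : PU21) : CyclicallyPermutes (k * g * k⁻¹) (k • p) (k • q) (k • r) := by
  refine ⟨?_, ?_, ?_⟩ <;> rw [mul_smul, mul_smul, inv_smul_smul]
  · rw [h.1]
  · rw [h.2.1]
  · rw [h.2.2]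

lemma IsAttached.conj {τ : Fin 4 → ℙ ℂ V} {J : PU21 × PU21} (h : IsAttached τ J) (k : PU21) :
    IsAttached (k • τ) (ConjAct.toConjAct k • J) :=
  ⟨h.1.conj k, h.2.conj k⟩

lemma Marked33InftyGroup.isTraceless_fst (J : Marked33InftyGroup) : IsTraceless J.1.1 :=
  isTraceless_of_isRegularElliptic J.2.1

lemma Marked33InftyGroup.isTraceless_snd (J : Marked33InftyGroup) : IsTraceless J.1.2 :=
  isTraceless_of_isRegularElliptic J.2.2.1

lemma attached_pair_unique_of_conj {τ : Fin 4 → ℙ ℂ V} (hτ : ∀ i, τ i ∈ boundary)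
    (hinj : Function.Injective τ) (J K : Marked33InftyGroup) (k : PU21) (hJ : IsAttached τ J.1)
    (hK : IsAttached τ (ConjAct.toConjAct k • K.1)) : J.1 = ConjAct.toConjAct k • K.1 :=
  attached_pair_unique hτ hinj J.isTraceless_fst J.isTraceless_snd (K.isTraceless_fst.conj k)
    (K.isTraceless_snd.conj k) hJ hK

/-- The bijection between balanced tetrahedra and marked groups. -/
noncomputable def tetrahedronEquiv : BalancedTetrahedron ≃ Marked33InftyGroup :=
  Equiv.ofBijective (fun τ => (exists_attached_pair τ).choose) <| by
    constructor
    · intro τ σ h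
      have h1 := (exists_attached_pair τ).choose_spec
      have h2 := (exists_attached_pair σ).choose_spec
      simp only at h
      rw [h] at h1
      exact Subtype.ext (attached_tetrahedron_unique τ.2.1 σ.2.1
        (exists_attached_pair σ).choose.2.2.2 h1 h2)
    · intro J
      obtain ⟨τ, hτ⟩ := exists_attached_tetrahedron J
      have h1 := (exists_attached_pair τ).choose_spec
      exact ⟨τ, Subtype.ext (attached_pair_unique τ.2.1 τ.2.2.1
        (Marked33InftyGroup.isTraceless_fst _) (Marked33InftyGroup.isTraceless_snd _)
        J.isTraceless_fst J.isTraceless_snd h1 hτ)⟩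

lemma isAttached_tetrahedronEquiv (τ : BalancedTetrahedron) :
    IsAttached τ.1 (tetrahedronEquiv τ).1 :=
  (exists_attached_pair τ).choose_spec

lemma tetrahedronSetoid_iff (τ σ : BalancedTetrahedron) :
    tetrahedronSetoid τ σ ↔ ∃ g : PU21, g • σ.1 = τ.1 := Iff.rfl

lemma markedSetoid_iff (J K : Marked33InftyGroup) :
    markedSetoid J K ↔ ∃ g : PU21, ConjAct.toConjAct g • K.1 = J.1 := Iff.rfl

lemma markedSetoid_tetrahedronEquiv (τ : BalancedTetrahedron) (J : Marked33InftyGroup) :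
    markedSetoid (tetrahedronEquiv τ) J ↔ ∃ g : PU21, IsAttached (g • τ.1) J.1 := by
  rw [markedSetoid_iff]
  constructor
  · rintro ⟨g, hg⟩
    refine ⟨g⁻¹, ?_⟩
    have h := (isAttached_tetrahedronEquiv τ).conj g⁻¹
    rwa [← hg, ConjAct.toConjAct_inv, inv_smul_smul] at h
  · rintro ⟨g, hg⟩
    have h := hg.conj g⁻¹
    rw [inv_smul_smul] at h
    exact ⟨g⁻¹, (attached_pair_unique_of_conj τ.2.1 τ.2.2.1 _ J g⁻¹
      (isAttached_tetrahedronEquiv τ) h).symm⟩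

/-- The bijection between orbits of balanced tetrahedra and classes of marked groups. -/
noncomputable def orbitsEquiv : TetrahedronOrbits ≃ Marked33InftyClasses :=
  Quotient.congr tetrahedronEquiv <| by
    intro τ σ
    rw [markedSetoid_tetrahedronEquiv, tetrahedronSetoid_iff]
    constructor
    · rintro ⟨g, hg⟩
      refine ⟨g⁻¹, ?_⟩
      rw [← hg, inv_smul_smul]
      exact isAttached_tetrahedronEquiv σ
    · rintro ⟨g, hg⟩
      refine ⟨g⁻¹, ?_⟩
      rw [inv_smul_eq_iff]
      exact attached_tetrahedron_unique σ.2.1 (fun i => smul_mem_boundary g (τ.2.1 i))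
        (tetrahedronEquiv σ).2.2.2 (isAttached_tetrahedronEquiv σ) hg

lemma orbitsEquiv_mk_eq_iff (τ : BalancedTetrahedron) (J : Marked33InftyGroup) :
    orbitsEquiv (Quotient.mk tetrahedronSetoid τ) = Quotient.mk markedSetoid J ↔
      ∃ g : PU21, IsAttached (g • τ.1) J.1 := by
  rw [← markedSetoid_tetrahedronEquiv]
  exact Quotient.eq (r := markedSetoid)

/-! ### Unmarked groups -/

/-- The vertex with horizontal angle determined by `s`. -/
noncomputable def vertex (s : ℝ) : V := ![⟨-s, √(1 - s ^ 2)⟩, (√(2 * s) : ℝ), 1]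

lemma norm_vertex_zero {s : ℝ} (hs : s ∈ Set.Ioo (0 : ℝ) 1) : ‖vertex s 0‖ = 1 := by
  have h : 0 ≤ 1 - s ^ 2 := by nlinarith [hs.1, hs.2]
  have : ‖vertex s 0‖ ^ 2 = 1 := by
    rw [← Complex.normSq_eq_norm_sq, Complex.normSq_apply]
    simp only [vertex, cons_val_zero]
    rw [Real.mul_self_sqrt h]; ring
  exact (pow_eq_one_iff_of_nonneg (norm_nonneg _) two_ne_zero).mp this

lemma herm_vertex {s : ℝ} (hs : s ∈ Set.Ioo (0 : ℝ) 1) : herm (vertex s) (vertex s) = 0 := by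
  have h : (√(2 * s) : ℝ) * √(2 * s) = 2 * s := Real.mul_self_sqrt (by linarith [hs.1])
  apply Complex.ext
  · simp only [herm, vertex, cons_val_zero, cons_val_one, cons_val]
    simp [-Real.sqrt_mul, -Real.sqrt_mul', h]
    ring
  · simp [herm, vertex]

lemma vertex_ne_zero (s : ℝ) : vertex s ≠ 0 := fun h => by
  simpa [vertex] using congrFun h 2

/-- A one-parameter family of ideal quadruples with three common vertices. -/
noncomputable def family (s : ℝ) : Fin 4 → ℙ ℂ V :=
  ![Projectivization.mk ℂ ![1, 0, 0] (fun h => by simpa using congrFun h 0),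
    Projectivization.mk ℂ ![0, 0, 1] (fun h => by simpa using congrFun h 2),
    Projectivization.mk ℂ (vertex s) (vertex_ne_zero s),
    Projectivization.mk ℂ ![Complex.I, 0, 1] (fun h => by simpa using congrFun h 2)]

lemma family_mem_boundary {s : ℝ} (hs : s ∈ Set.Ioo (0 : ℝ) 1) (i : Fin 4) :
    family s i ∈ boundary := by
  fin_cases i <;> refine (mk_mem_boundary _).mpr ?_
  · simp [herm]
  · simp [herm]
  · exact herm_vertex hs
  · simp [herm]

lemma mk_ne_mk_of_herm_ne_zero {u v : V} (hu0 : u ≠ 0) (hv0 : v ≠ 0) (hu : herm u u = 0)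
    (huv : herm u v ≠ 0) : Projectivization.mk ℂ u hu0 ≠ Projectivization.mk ℂ v hv0 := by
  intro h
  obtain ⟨a, ha⟩ := (Projectivization.mk_eq_mk_iff' ..).mp h.symm
  exact huv (by rw [← ha, herm_smul_right, hu, mul_zero])

lemma family_injective {s : ℝ} (hs : s ∈ Set.Ioo (0 : ℝ) 1) : Function.Injective (family s) := by
  have hs0 : vertex s 0 ≠ 0 := by
    rw [← norm_ne_zero_iff, norm_vertex_zero hs]; exact one_ne_zero
  have n01 : family s 0 ≠ family s 1 :=
    mk_ne_mk_of_herm_ne_zero _ _ (by simp [herm]) (by simp [herm])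
  have n02 : family s 0 ≠ family s 2 :=
    mk_ne_mk_of_herm_ne_zero _ _ (by simp [herm]) (by simp [herm, vertex])
  have n03 : family s 0 ≠ family s 3 :=
    mk_ne_mk_of_herm_ne_zero _ _ (by simp [herm]) (by simp [herm])
  have n12 : family s 1 ≠ family s 2 :=
    mk_ne_mk_of_herm_ne_zero _ _ (by simp [herm]) (by simpa [herm] using hs0)
  have n13 : family s 1 ≠ family s 3 :=
    mk_ne_mk_of_herm_ne_zero _ _ (by simp [herm]) (by simp [herm])
  have n23 : family s 2 ≠ family s 3 := by
    refine mk_ne_mk_of_herm_ne_zero _ _ (herm_vertex hs) fun h => hs.1.ne' ?_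
    simpa [herm, vertex] using congrArg Complex.re h
  intro i j hij
  fin_cases i <;> fin_cases j <;>
    first
    | rfl
    | exact absurd hij n01 | exact absurd hij n02 | exact absurd hij n03
    | exact absurd hij n12 | exact absurd hij n13 | exact absurd hij n23
    | exact absurd hij.symm n01 | exact absurd hij.symm n02 | exact absurd hij.symm n03
    | exact absurd hij.symm n12 | exact absurd hij.symm n13 | exact absurd hij.symm n23

lemma family_isBalanced {s : ℝ} (hs : s ∈ Set.Ioo (0 : ℝ) 1) : IsBalanced (family s) := by
  have h1 := norm_vertex_zero hs
  have hs0 : vertex s 0 ≠ 0 := by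
    rw [← norm_ne_zero_iff, h1]; exact one_ne_zero
  have e1 : herm (vertex s) ![1, 0, 0] = 1 := by simp [herm, vertex]
  have e2 : herm (vertex s) ![0, 0, 1] = vertex s 0 := by simp [herm]
  have e3 : herm ![Complex.I, 0, 1] ![1, 0, 0] = 1 := by simp [herm]
  have e4 : herm ![Complex.I, 0, 1] ![0, 0, 1] = Complex.I := by simp [herm]
  rw [isBalanced_iff _ _ _ _ (rfl : family s 0 = _) (rfl : family s 1 = _) (rfl : family s 2 = _)
    (rfl : family s 3 = _) (by simp [herm]) (by simp [herm]) (by simp [herm])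
    (by rw [e1]; exact one_ne_zero) (by rwa [e2]) (by rw [e3]; exact one_ne_zero)
    (by rw [e4]; exact Complex.I_ne_zero), e1, e2, e3, e4, h1]
  simp

lemma eq_of_smul_family_eq {s t : ℝ} (hs : s ∈ Set.Ioo (0 : ℝ) 1) (ht : t ∈ Set.Ioo (0 : ℝ) 1)
    {g : PU21} (h : g • family t = family s) : s = t := by
  obtain ⟨A, hU, hA⟩ := exists_lift g
  have h0 := (smul_mk_eq_mk_iff hU hA _ _).mp (congrFun h 0)
  have h1 := (smul_mk_eq_mk_iff hU hA _ _).mp (congrFun h 1)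
  have h2 := (smul_mk_eq_mk_iff hU hA _ _).mp (congrFun h 2)
  obtain ⟨a, ha⟩ := h0
  obtain ⟨b, hb⟩ := h1
  obtain ⟨c, hc⟩ := h2
  have k1 := mem_U21_iff.mp hU ![1, 0, 0] ![0, 0, 1]
  have k2 := mem_U21_iff.mp hU (vertex t) ![1, 0, 0]
  have k3 := mem_U21_iff.mp hU (vertex t) ![0, 0, 1]
  rw [ha, hb, herm_smul_left, herm_smul_right] at k1
  rw [hc, ha, herm_smul_left, herm_smul_right] at k2
  rw [hc, hb, herm_smul_left, herm_smul_right] at k3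
  have e (r : ℝ) : herm (vertex r) ![1, 0, 0] = 1 := by simp [herm, vertex]
  have e' (r : ℝ) : herm (vertex r) ![0, 0, 1] = vertex r 0 := by simp [herm]
  have e1 : herm ![1, 0, 0] ![0, 0, 1] = 1 := by simp [herm]
  rw [e1, mul_one] at k1
  rw [e, e, mul_one] at k2
  rw [e', e'] at k3
  have key : (Complex.normSq a : ℂ) * vertex t 0 = vertex s 0 := by
    rw [← Complex.mul_conj, ← k3]
    linear_combination (c * conj a * vertex s 0) * k1 + vertex s 0 * k2
  have hn := congrArg norm key
  rw [norm_mul, norm_vertex_zero ht, norm_vertex_zero hs, mul_one, Complex.norm_real,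
    Real.norm_of_nonneg (Complex.normSq_nonneg a)] at hn
  rw [hn, Complex.ofReal_one, one_mul] at key
  simpa [vertex, eq_comm] using congrArg Complex.re key

lemma aleph0_lt_mk_tetrahedronOrbits : Cardinal.aleph0 < Cardinal.mk TetrahedronOrbits := by
  have hinj : Function.Injective (fun s : Set.Ioo (0 : ℝ) 1 =>
      (Quotient.mk tetrahedronSetoid ⟨family s, family_mem_boundary s.2, family_injective s.2,
        family_isBalanced s.2⟩ : TetrahedronOrbits)) := by
    intro s t h
    obtain ⟨g, hg⟩ := (tetrahedronSetoid_iff _ _).mp (Quotient.exact h)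
    exact Subtype.ext (eq_of_smul_family_eq s.2 t.2 hg)
  have := Cardinal.mk_le_of_injective hinj
  rw [Cardinal.mk_Ioo_real zero_lt_one] at this
  exact Cardinal.aleph0_lt_continuum.trans_le this

open scoped Pointwise

lemma unmarkedSetoid_iff (H K : Unmarked33InftyGroup) :
    unmarkedSetoid H K ↔ ∃ g : ConjAct PU21, g • K.1 = H.1 := Iff.rfl

lemma countable_closure_pair {G : Type*} [Group G] (a b : G) :
    Countable (Subgroup.closure {a, b} : Subgroup G) := by
  have h : Subgroup.closure {a, b} = (FreeGroup.lift ![a, b]).range := by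
    rw [FreeGroup.range_lift_eq_closure, Matrix.range_cons, Matrix.range_cons, Matrix.range_empty,
      Set.union_empty, Set.singleton_union]
  have : Countable (FreeGroup (Fin 2)) := Quot.mk_surjective.countable
  rw [h]
  exact (FreeGroup.lift ![a, b]).rangeRestrict_surjective.countable

/-- The subgroup generated by a marked group. -/
def forgetMarking (J : Marked33InftyGroup) : Unmarked33InftyGroup :=
  ⟨Subgroup.closure {J.1.1, J.1.2}, J.1, J.2, rfl⟩

lemma smul_closure_pair (g : ConjAct PU21) (J : PU21 × PU21) :
    g • Subgroup.closure {J.1, J.2} = Subgroup.closure {(g • J).1, (g • J).2} := by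
  rw [Subgroup.smul_closure, Set.smul_set_insert, Set.smul_set_singleton]
  rfl

/-- Forgetting the marking of conjugacy classes. -/
def forgetMarkingClass : Marked33InftyClasses → Unmarked33InftyClasses :=
  Quotient.map forgetMarking <| by
    rintro J K ⟨g, hg⟩
    refine ⟨g, ?_⟩
    change g • Subgroup.closure {K.1.1, K.1.2} = Subgroup.closure {J.1.1, J.1.2}
    rw [smul_closure_pair, ← hg]

lemma forgetMarkingClass_surjective : Function.Surjective forgetMarkingClass := by
  intro c
  induction c using Quotient.inductionOn with | _ H
  obtain ⟨H, J, hJ, rfl⟩ := H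
  exact ⟨Quotient.mk _ ⟨J, hJ⟩, rfl⟩

/-- A group has only countably many markings up to conjugacy. -/
lemma countable_fiber (c : Unmarked33InftyClasses) : (forgetMarkingClass ⁻¹' {c}).Countable := by
  induction c using Quotient.inductionOn with | _ H
  have hH : Countable H.1 := by
    obtain ⟨H, J, hJ, rfl⟩ := H
    exact countable_closure_pair _ _
  have hex (x : forgetMarkingClass ⁻¹' {Quotient.mk unmarkedSetoid H}) :
      ∃ y : H.1 × H.1, ∃ g : ConjAct PU21, ∃ J : Marked33InftyGroup,
        x.1 = Quotient.mk markedSetoid J ∧ g • J.1 = ((y.1 : PU21), (y.2 : PU21)) := by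
    obtain ⟨x, hx⟩ := x
    induction x using Quotient.inductionOn with | _ J
    obtain ⟨g, hg⟩ := (unmarkedSetoid_iff _ _).mp (Quotient.exact hx.symm)
    change g • Subgroup.closure {J.1.1, J.1.2} = H.1 at hg
    rw [smul_closure_pair] at hg
    exact ⟨(⟨(g • J.1).1, hg ▸ Subgroup.subset_closure (by simp)⟩,
      ⟨(g • J.1).2, hg ▸ Subgroup.subset_closure (by simp)⟩), g, J, rfl, rfl⟩
  choose y g J hx hJ using hex
  have hinj : Function.Injective y := by
    intro a b hab
    apply Subtype.ext
    rw [hx a, hx b]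
    apply Quotient.sound
    refine ⟨(g a)⁻¹ * g b, ?_⟩
    change ((g a)⁻¹ * g b) • (J b).1 = (J a).1
    rw [mul_smul, hJ b, ← hab, ← hJ a, inv_smul_smul]
  exact Set.countable_coe_iff.mp hinj.countable

lemma mk_marked_eq_mk_unmarked :
    Cardinal.mk Marked33InftyClasses = Cardinal.mk Unmarked33InftyClasses := by
  have hM : Cardinal.aleph0 < Cardinal.mk Marked33InftyClasses := by
    rw [← Cardinal.mk_congr orbitsEquiv]; exact aleph0_lt_mk_tetrahedronOrbits
  have hle : Cardinal.mk Marked33InftyClasses ≤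
      Cardinal.mk Unmarked33InftyClasses * Cardinal.aleph0 :=
    Cardinal.mk_le_mk_mul_of_mk_preimage_le forgetMarkingClass
      fun c => Cardinal.mk_le_aleph0_iff.mpr (countable_fiber c).to_subtype
  have hU : Cardinal.aleph0 ≤ Cardinal.mk Unmarked33InftyClasses := by
    by_contra! h
    have := hle.trans (mul_le_mul_left h.le _)
    rw [Cardinal.aleph0_mul_aleph0] at this
    exact absurd hM this.not_gt
  refine le_antisymm ?_ (Cardinal.mk_le_of_surjective forgetMarkingClass_surjective)
  rwa [Cardinal.mul_aleph0_eq hU] at hle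

end ComplexHyperbolic

theorem theorem4p6 :
    (∃ F : ComplexHyperbolic.TetrahedronOrbits ≃ ComplexHyperbolic.Marked33InftyClasses,
      ∀ (τ : ComplexHyperbolic.BalancedTetrahedron) (J : ComplexHyperbolic.Marked33InftyGroup),
        F (Quotient.mk ComplexHyperbolic.tetrahedronSetoid τ) =
            Quotient.mk ComplexHyperbolic.markedSetoid J ↔
          ∃ g : ComplexHyperbolic.PU21, ComplexHyperbolic.IsAttached (g • τ.1) J.1) ∧
    Nonempty (ComplexHyperbolic.TetrahedronOrbits ≃ ComplexHyperbolic.Unmarked33InftyClasses) :=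
  ⟨⟨ComplexHyperbolic.orbitsEquiv, ComplexHyperbolic.orbitsEquiv_mk_eq_iff⟩,
    Cardinal.eq.mp <| (Cardinal.mk_congr ComplexHyperbolic.orbitsEquiv).trans
      ComplexHyperbolic.mk_marked_eq_mk_unmarked⟩
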